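/- **Setting.** Let $(\mathcal X,\to)$ be a countable directed graph with arc set $\mathcal A\subset\mathcal X\times\mathcal X$ that is symmetric, connected, of bounded degree and without loops. Let $\Omega$ be the set of all càdlàg piecewise constant paths $\omega:[0,1]\to\mathcal X$ with finitely many jumps, all along arcs, and with $\omega_{1^-}=\omega_1$; let $X=(X_t)_{0\le t\le 1}$ be the canonical process and equip $\Omega$ with the $\sigma$-field it generates. Let $j:[0,1]\times\mathcal A\to(0,\infty)$ be such that $t\mapsto j(t,z\to z')$ is continuously differentiable on $[0,1]$ for each arc, and $\sup_{t,z}\bar j(t,z)<\infty$, where $\bar j(t,z):=\sum_{z':z\to z'}j(t,z\to z')$. For each $x\in\mathcal X$ let $R^x$ be the solution, as a probability measure on $\Omega$, of the martingale problem with initial law $\delta_x$ and generator $L_tu(z)=\sum_{z':z\to z'}j(t,z\to z')(u_{z'}-u_z)$, $u$ finitely supported. Let $R=\sum_xR_0(x)R^x$, where $R_0$ is a probability measure on $\mathcal X$ with full support, and let $R^{xy}=R(\cdot\mid X_0=x,X_1=y)$. The reciprocal class of $j$ is $$\mathcal R(j)=\Big\{\sum_{x,y}\pi(x,y)R^{xy}:\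 \pi \text{ a probability measure on } \mathcal X^2,\ \operatorname{supp}\pi\subset\operatorname{supp}R_{01}\Big\},$$ where $R_{01}$ is the law of $(X_0,X_1)$ under $R$. For $t\in(0,1)$, an arc $z\to z'$ and a closed walk $\mathbf c=(x_0\to x_1\to\cdots\to x_{|\mathbf c|}=x_0)$ of length $|\mathbf c|\ge1$, put $$\chi_a[j](t,z\to z')=\partial_t\log j(t,z\to z')+\bar j(t,z')-\bar j(t,z),\qquad \chi_c[j](t,\mathbf c)=\prod_{i=0}^{|\mathbf c|-1}j(t,x_i\to x_{i+1}).$$ Let $T^t_0:=t$ and, for $k\ge1$, let $T^t_k$ be the $k$-th jump time of $X$ in $(t,1]$, with $T^t_k=+\infty$ if there is none. **Theorem.** Let $P\in\mathcal R(j)$. (a) For all $t\in(0,1)$ and all $(z\to z')\in\mathcal A$, as $h\to0^+$, $$P\big(T^t_1\le t+h/2\ \big|\ X_t=z,\ X_{t+h}=z',\ T^t_2>t+h\big)=\frac12-\frac h8\,\chi_a[j](t,z\to z')+o(h).$$ (b) For all $t\in(0,1)$ and every closed walk $\mathbf c=(x_0\to\cdots\to x_{|\mathbf c|}=x_0)$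 with $|\mathbf c|\ge1$, as $h\to0^+$, $$P\big((X_{T^t_0},X_{T^t_1},\dots,X_{T^t_{|\mathbf c|}})=(x_0,x_1,\dots,x_{|\mathbf c|}),\ T^t_{|\mathbf c|}<t+h<T^t_{|\mathbf c|+1}\ \big|\ X_t=X_{t+h}=x_0\big)=\chi_c[j](t,\mathbf c)\,\frac{h^{|\mathbf c|}}{|\mathbf c|!}+o\big(h^{|\mathbf c|}\big).$$ -/

import Mathlib

open Set Filter Topology MeasureTheory ProbabilityTheory Asymptotics

namespace RecipWalk

noncomputable section

/-! A directed graph that is symmetric and has no loops is a `SimpleGraph`: the arcs are the ordered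
pairs `(z, z')` with `G.Adj z z'`, and the directed walks are the terms of `G.Walk`. -/

/-- `a` is the left limit of `w` at `s` (discrete state space; meaningful for `0 < s`). -/
def HasLeftLimit {V : Type*} (w : unitInterval → V) (s : unitInterval) (a : V) : Prop :=
  ∀ᶠ r in 𝓝[<] s, w r = a

/-- `s` is a jump time of `w`, that is `w (s-) ≠ w s`. It never holds at `s = 0`, where the filter
of left neighbourhoods is trivial. -/
def IsJump {V : Type*} (w : unitInterval → V) (s : unitInterval) : Prop :=
  ¬ HasLeftLimit w s (w s)

/-- Càdlàg piecewise constant paths on `[0,1]` with finitely many jumps, all of them along arcs of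
the graph, and no jump at time `1`. -/
structure IsStepPath {V : Type*} (G : SimpleGraph V) (w : unitInterval → V) : Prop where
  right_cont : ∀ s : unitInterval, s < 1 → ∀ᶠ r in 𝓝[>] s, w r = w s
  left_lim : ∀ s : unitInterval, 0 < s → ∃ a, HasLeftLimit w s a
  finite_jumps : {s : unitInterval | IsJump w s}.Finite
  left_cont_one : HasLeftLimit w 1 (w 1)
  jump_adj : ∀ s : unitInterval, 0 < s → s < 1 → ∀ a, HasLeftLimit w s a → a ≠ w s → G.Adj a (w s)

/-- The path space. -/
def PathSpace {V : Type*} (G : SimpleGraph V) : Type _ :=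
  {w : unitInterval → V // IsStepPath G w}

/-- The canonical process with time in `[0,1]`. -/
def coord {V : Type*} {G : SimpleGraph V} (s : unitInterval) (w : PathSpace G) : V := w.1 s

/-- The canonical process at a real time `t`; only times in `[0,1]` are meaningful. -/
def pos {V : Type*} {G : SimpleGraph V} (t : ℝ) (w : PathSpace G) : V :=
  coord (Set.projIcc 0 1 zero_le_one t) w

/-- The canonical σ-field, generated by the canonical process; the state space is discrete. -/
instance instMeasurableSpacePathSpace {V : Type*} (G : SimpleGraph V) :
    MeasurableSpace (PathSpace G) :=
  ⨆ s : unitInterval, MeasurableSpace.comap (coord s) ⊤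

/-- The canonical filtration `σ(X_s, s ≤ t)`. -/
def canonicalFiltration {V : Type*} (G : SimpleGraph V) :
    Filtration unitInterval (instMeasurableSpacePathSpace G) where
  seq t := ⨆ s : unitInterval, ⨆ _ : s ≤ t, MeasurableSpace.comap (coord s) ⊤
  mono' := fun _ _ hst => iSup_mono fun _ => iSup_mono' fun h => ⟨h.trans hst, le_rfl⟩
  le' := fun _ => iSup_mono fun _ => iSup_le fun _ => le_rfl

/-- `jumpTime t k w` is the `k`-th instant of jump after time `t`, for `k ≥ 1`, with `inf ∅ = ∞`;
the recursion starts at `jumpTime t 0 w = t`. -/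
def jumpTime {V : Type*} {G : SimpleGraph V} (t : ℝ) : ℕ → PathSpace G → EReal
  | 0, _ => (t : EReal)
  | k + 1, w =>
      sInf ((fun s : unitInterval => ((s : ℝ) : EReal)) ''
        {s : unitInterval | jumpTime t k w < ((s : ℝ) : EReal) ∧ IsJump w.1 s})

/-- Average frequency of jump from `z` at time `t`: the sum of `j t z z'` over the arcs `z → z'`. -/
def totalRate {V : Type*} (G : SimpleGraph V) [G.LocallyFinite] (j : ℝ → V → V → ℝ)
    (t : ℝ) (z : V) : ℝ :=
  ∑ z' ∈ G.neighborFinset z, j t z z'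

/-- The generator `L_t u (z)`, the sum of `j t z z' * (u z' - u z)` over the arcs `z → z'`. -/
def generator {V : Type*} (G : SimpleGraph V) [G.LocallyFinite] (j : ℝ → V → V → ℝ)
    (t : ℝ) (u : V → ℝ) (z : V) : ℝ :=
  ∑ z' ∈ G.neighborFinset z, j t z z' * (u z' - u z)

/-- Requirements on the reference jump intensity `j : [0,1] × {arcs} → [0, ∞)`. The values of `j`
at other times and at pairs that are not arcs are irrelevant. -/
structure IsAdmissibleIntensity {V : Type*} (G : SimpleGraph V) [G.LocallyFinite]
    (j : ℝ → V → V → ℝ) : Prop where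
  bounded : ∃ C : ℝ, ∀ t ∈ Icc (0 : ℝ) 1, ∀ z, totalRate G j t z ≤ C
  contDiff : ∀ z z', G.Adj z z' → ContDiffOn ℝ 1 (fun t => j t z z') (Icc 0 1)
  pos : ∀ t ∈ Icc (0 : ℝ) 1, ∀ z z', G.Adj z z' → 0 < j t z z'

/-- The probability measure `Q` on path space solves the martingale problem for the generator of
intensity `j` with initial marginal the Dirac mass at `x`. -/
structure SolvesMartingaleProblem {V : Type*} (G : SimpleGraph V) [G.LocallyFinite]
    (j : ℝ → V → V → ℝ) (x : V) (Q : Measure (PathSpace G)) : Prop where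
  isProb : IsProbabilityMeasure Q
  initial : ∀ᵐ w ∂Q, coord 0 w = x
  martingale : ∀ u : V → ℝ, (Function.support u).Finite →
    Martingale (fun (t : unitInterval) (w : PathSpace G) =>
        u (coord t w) - ∫ s in (0 : ℝ)..(t : ℝ), generator G j s u (pos s w))
      (canonicalFiltration G) Q

/-- Reference walks: `R = ∑ x, R₀(x) R^x` where `R₀` is a probability on the vertices with full
support and `R^x` solves the martingale problem of intensity `j` started at `x`. -/
def IsReferenceWalk {V : Type*} (G : SimpleGraph V) [G.LocallyFinite]
    (j : ℝ → V → V → ℝ) (R : Measure (PathSpace G)) : Prop :=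
  ∃ (R₀ : PMF V) (Rx : V → Measure (PathSpace G)), R₀.support = Set.univ ∧
    (∀ x, SolvesMartingaleProblem G j x (Rx x)) ∧ R = Measure.sum fun x => R₀ x • Rx x

/-- The bridge `R^{xy} = R(· | X_0 = x, X_1 = y)`. -/
def bridge {V : Type*} {G : SimpleGraph V} (R : Measure (PathSpace G)) (x y : V) :
    Measure (PathSpace G) :=
  ProbabilityTheory.cond R {w | coord 0 w = x ∧ coord 1 w = y}

/-- The support of the law of the endpoint position `(X_0, X_1)` under `R`. -/
def endpointSupport {V : Type*} {G : SimpleGraph V} (R : Measure (PathSpace G)) : Set (V × V) :=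
  {p | R {w | coord 0 w = p.1 ∧ coord 1 w = p.2} ≠ 0}

/-- The reciprocal class of the intensity `j`: all mixtures of the bridges of the reference walk. -/
def reciprocalClass {V : Type*} (G : SimpleGraph V) [G.LocallyFinite]
    (j : ℝ → V → V → ℝ) : Set (Measure (PathSpace G)) :=
  {P | ∃ R, IsReferenceWalk G j R ∧ ∃ π : PMF (V × V), π.support ⊆ endpointSupport R ∧
    P = Measure.sum fun p => π p • bridge R p.1 p.2}

/-- Arc component of the reciprocal characteristic. -/
def arcCharacteristic {V : Type*} (G : SimpleGraph V) [G.LocallyFinite] (j : ℝ → V → V → ℝ)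
    (t : ℝ) (z z' : V) : ℝ :=
  deriv (fun s => Real.log (j s z z')) t + totalRate G j t z' - totalRate G j t z

/-- Closed walk component of the reciprocal characteristic. -/
def walkCharacteristic {V : Type*} {G : SimpleGraph V} (j : ℝ → V → V → ℝ)
    (t : ℝ) {x : V} (c : G.Walk x x) : ℝ :=
  ∏ i ∈ Finset.range c.length, j t (c.getVert i) (c.getVert (i + 1))

end

end RecipWalk

/-!
A member `P` of the reciprocal class is a mixture of bridges of reference walks. Conditioning on
the positions `X_t = a` and `X_s = b` makes the endpoints irrelevant: on events of the time interval
`[t, s]` that fix these two positions, `P` is a constant `K > 0` times the law of the Markov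
dynamics of intensity `j` started from `a` at time `t` (`exists_measureReal_eq_mul`). The constant
cancels in the conditional probabilities, so both expansions reduce to explicit computations for
the Markov dynamics.

The only information on the reference walks is the martingale problem. It is turned into an
explicit formula: given the past of `t` and `X_t = a`, the probability that the states visited
during `[t, s]` are exactly those of a given list is an iterated integral `walkWeight`
(`SolvesMartingaleProblem.measureReal_skeleton`). For the proof, the path is observed on the grid
`t + i δ`. Paths are piecewise constant with finitely many jumps, so on a fine enough grid the
observed list of states is the true one (`eventually_trail_eq_skeleton`). On the grid, the
martingale property for indicators of states gives a one-step recursion with an error `O(δ ^ 2)`,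
uniformly in the past. This recursion is the Euler scheme of the linear differential equations
solved by `walkWeight`, hence the errors sum up to `O(δ)`. The formula contains the Markov property
and does not depend on the solution of the martingale problem. Summing it over all lists that end in
a given state expresses the transition probabilities, which are positive since the graph is
connected.

For a closed walk `c` of length `n` from `x` to `x`, the conditional probability is `walkWeight`
divided by a return probability that tends to `1`, and `walkWeight` is equivalent to
`χ_c h ^ n / n!` by induction on the walk (`tendsto_walkWeight_history_div`). For an arc `z → z'`,
the time `r` of the single jump has a conditional density on `[t, t + h]` proportional to
`φ r = j(r, z → z') exp (∫_t^r (jbar z' - jbar z))`, where `jbar` is the total jump rate. Its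
logarithmic derivative at `t` is the arc characteristic `χ_a`, and the expansion
`Φ(h / 2) / Φ(h) = 1 / 2 - h χ_a / 8 + o(h)`, with `Φ(h)` the integral of `φ` over `[t, t + h]`,
is elementary (`isLittleO_integral_ratio`).
-/

/-! ### Jump times and visited states of a step path -/

namespace RecipWalk

section Paths

variable {V : Type*} {G : SimpleGraph V}

theorem pos_of_mem {t : ℝ} (ht : t ∈ Icc (0 : ℝ) 1) (w : PathSpace G) :
    pos t w = w.1 ⟨t, ht⟩ := by
  simp [pos, coord, projIcc_of_mem zero_le_one ht]

theorem eventually_gt_eq (w : PathSpace G) (s : unitInterval) :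
    ∀ᶠ r in 𝓝[>] s, w.1 r = w.1 s := by
  rcases eq_or_lt_of_le (show s ≤ 1 from s.2.2) with rfl | h
  · have : Ioi (1 : unitInterval) = ∅ := by
      ext x; simpa using (show x ≤ 1 from x.2.2)
    simp [this]
  · exact w.2.right_cont s h

theorem eventually_nhds_eq (w : PathSpace G) {s : unitInterval} (h : ¬ IsJump w.1 s) :
    ∀ᶠ r in 𝓝 s, w.1 r = w.1 s := by
  have hl : ∀ᶠ r in 𝓝[<] s, w.1 r = w.1 s := not_not.mp h
  rw [← nhdsLT_sup_nhdsGE, eventually_sup]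
  refine ⟨hl, ?_⟩
  rw [← Ioi_union_left, nhdsWithin_union, eventually_sup]
  exact ⟨eventually_gt_eq w s, by simp⟩

theorem eq_of_forall_not_isJump (w : PathSpace G) {u v : unitInterval} (huv : u ≤ v)
    (h : ∀ r, u < r → r ≤ v → ¬ IsJump w.1 r) : w.1 v = w.1 u := by
  let _ : TopologicalSpace V := ⊥
  have _ : DiscreteTopology V := ⟨rfl⟩
  have hc : ContinuousOn w.1 (Icc u v) := by
    intro r hr
    rw [ContinuousWithinAt, nhds_discrete, tendsto_pure]
    rcases eq_or_lt_of_le hr.1 with rfl | hlt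
    · have : ∀ᶠ x in 𝓝[≥] u, w.1 x = w.1 u := by
        rw [← Ioi_union_left, nhdsWithin_union, eventually_sup]
        exact ⟨eventually_gt_eq w u, by simp⟩
      exact this.filter_mono (nhdsWithin_mono _ fun x hx => hx.1)
    · exact (eventually_nhds_eq w (h r hlt hr.2)).filter_mono nhdsWithin_le_nhds
  exact isPreconnected_Icc.constant hc (right_mem_Icc.2 huv) (left_mem_Icc.2 huv)

theorem jumpTime_succ_le {t : ℝ} {k : ℕ} {w : PathSpace G} {s : unitInterval}
    (hs : IsJump w.1 s) (h : jumpTime t k w < ((s : ℝ) : EReal)) :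
    jumpTime t (k + 1) w ≤ ((s : ℝ) : EReal) :=
  sInf_le ⟨s, ⟨h, hs⟩, rfl⟩

/-- There are finitely many jumps, so the infimum defining a finite jump time is attained. -/
theorem jumpTime_succ_eq_top_or (t : ℝ) (k : ℕ) (w : PathSpace G) :
    jumpTime t (k + 1) w = ⊤ ∨ ∃ s : unitInterval, jumpTime t (k + 1) w = ((s : ℝ) : EReal) ∧
      jumpTime t k w < ((s : ℝ) : EReal) ∧ IsJump w.1 s := by
  set A := {s : unitInterval | jumpTime t k w < ((s : ℝ) : EReal) ∧ IsJump w.1 s} with hA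
  rcases A.eq_empty_or_nonempty with h | h
  · left
    change sInf ((fun s : unitInterval => ((s : ℝ) : EReal)) '' A) = ⊤
    simp [h]
  · right
    have hf : A.Finite := w.2.finite_jumps.subset fun s hs => hs.2
    obtain ⟨s, hs, hse⟩ := (h.image (fun s : unitInterval => ((s : ℝ) : EReal))).csInf_mem
      (hf.image _)
    exact ⟨s, hse.symm, hs.1, hs.2⟩

theorem jumpTime_lt_succ {t : ℝ} {k : ℕ} {w : PathSpace G} (h : jumpTime t k w ≠ ⊤) :
    jumpTime t k w < jumpTime t (k + 1) w := by
  rcases jumpTime_succ_eq_top_or t k w with h1 | ⟨s, h1, h2, -⟩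
  · rw [h1]; exact lt_top_iff_ne_top.2 h
  · rw [h1]; exact h2

theorem jumpTime_mono (t : ℝ) (w : PathSpace G) : Monotone fun k => jumpTime t k w := by
  refine monotone_nat_of_le_succ fun k => ?_
  rcases eq_or_ne (jumpTime t k w) ⊤ with h | h
  · rcases jumpTime_succ_eq_top_or t k w with h1 | ⟨s, h1, h2, -⟩
    · simp [h1]
    · simp [h] at h2
  · exact (jumpTime_lt_succ h).le

theorem le_jumpTime (t : ℝ) (k : ℕ) (w : PathSpace G) : (t : EReal) ≤ jumpTime t k w :=
  jumpTime_mono t w (Nat.zero_le k)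

theorem coe_toReal_jumpTime {t r : ℝ} {k : ℕ} {w : PathSpace G}
    (h : jumpTime t k w ≤ (r : EReal)) :
    (((jumpTime t k w).toReal : ℝ) : EReal) = jumpTime t k w :=
  EReal.coe_toReal (ne_top_of_le_ne_top (EReal.coe_ne_top r) h)
    (ne_bot_of_le_ne_bot (EReal.coe_ne_bot t) (le_jumpTime t k w))

theorem pos_eq_of_jumpTime_le {t r : ℝ} (ht : 0 ≤ t) (hr : r ≤ 1) {k : ℕ} {w : PathSpace G}
    (h1 : jumpTime t k w ≤ (r : EReal)) (h2 : (r : EReal) < jumpTime t (k + 1) w) :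
    pos r w = pos (jumpTime t k w).toReal w := by
  have hc := coe_toReal_jumpTime h1
  set T := (jumpTime t k w).toReal with hT
  have htT : t ≤ T := by
    rw [← EReal.coe_le_coe_iff, hc]; exact le_jumpTime t k w
  have hTr : T ≤ r := by
    rw [← EReal.coe_le_coe_iff, hc]; exact h1
  rw [pos_of_mem ⟨ht.trans (htT.trans hTr), hr⟩, pos_of_mem ⟨ht.trans htT, hTr.trans hr⟩]
  refine eq_of_forall_not_isJump w hTr fun s hs hsr hj => ?_
  have : jumpTime t k w < ((s : ℝ) : EReal) := by
    rw [← hc, EReal.coe_lt_coe_iff]; exact hs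
  exact absurd ((jumpTime_succ_le hj this).trans (EReal.coe_le_coe_iff.2 hsr)) (not_le.2 h2)

/-- Consecutive visited states differ. -/
theorem pos_jumpTime_succ_ne {t : ℝ} (ht : 0 ≤ t) {k : ℕ} {w : PathSpace G}
    (h : jumpTime t (k + 1) w ≠ ⊤) :
    pos (jumpTime t (k + 1) w).toReal w ≠ pos (jumpTime t k w).toReal w := by
  rcases jumpTime_succ_eq_top_or t k w with h1 | ⟨s, h1, h2, hj⟩
  · exact absurd h1 h
  intro he
  apply hj
  have hc := coe_toReal_jumpTime h2.le
  set T := (jumpTime t k w).toReal with hT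
  have htT : t ≤ T := by
    rw [← EReal.coe_le_coe_iff, hc]; exact le_jumpTime t k w
  have hTs : T < (s : ℝ) := by
    rw [← EReal.coe_lt_coe_iff, hc]; exact h2
  have hw : w.1 s = pos T w := by
    rw [← he, h1, EReal.toReal_coe, pos_of_mem s.2]
  have hTm : T ∈ Icc (0 : ℝ) 1 := ⟨ht.trans htT, hTs.le.trans s.2.2⟩
  have : Ioo (⟨T, hTm⟩ : unitInterval) s ∈ 𝓝[<] s := Ioo_mem_nhdsLT hTs
  filter_upwards [this] with r hr
  rw [hw, ← pos_of_mem r.2 w]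
  refine pos_eq_of_jumpTime_le ht r.2.2 ?_ ?_
  · rw [← hc, EReal.coe_le_coe_iff]; exact hr.1.le
  · rw [h1, EReal.coe_lt_coe_iff]; exact hr.2

/-- `history f n = [f n, …, f 1, f 0]`. -/
def history {α : Type*} (f : ℕ → α) : ℕ → List α
  | 0 => [f 0]
  | n + 1 => f (n + 1) :: history f n

theorem length_history {α : Type*} (f : ℕ → α) (n : ℕ) : (history f n).length = n + 1 := by
  induction n with
  | zero => rfl
  | succ n ih => simp [history, ih]

theorem head?_history {α : Type*} (f : ℕ → α) (n : ℕ) : (history f n).head? = some (f n) := by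
  cases n <;> rfl

theorem history_eq_iff {α : Type*} (f g : ℕ → α) (n : ℕ) :
    history f n = history g n ↔ ∀ i ≤ n, f i = g i := by
  induction n with
  | zero => simp [history]
  | succ n ih =>
    simp only [history, List.cons.injEq, ih]
    constructor
    · rintro ⟨h1, h2⟩ i hi
      rcases Nat.le_succ_iff.1 hi with h | h
      · exact h2 i h
      · exact h ▸ h1
    · exact fun h => ⟨h _ le_rfl, fun i hi => h i (hi.trans (Nat.le_succ n))⟩

/-- The number of jumps in `(t, s]`. -/
noncomputable def jumpCount (t s : ℝ) (w : PathSpace G) : ℕ :=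
  sInf {n : ℕ | (s : EReal) < jumpTime t (n + 1) w}

/-- The states visited during `[t, s]`, without holding times, the most recent one first. -/
noncomputable def skeleton (t s : ℝ) (w : PathSpace G) : List V :=
  history (fun k => pos (jumpTime t k w).toReal w) (jumpCount t s w)

theorem lt_jumpTime_jumpCount_succ (t s : ℝ) (w : PathSpace G) :
    (s : EReal) < jumpTime t (jumpCount t s w + 1) w := by
  have hne : {n : ℕ | (s : EReal) < jumpTime t (n + 1) w}.Nonempty := by
    by_contra hcon
    rw [not_nonempty_iff_eq_empty, eq_empty_iff_forall_notMem] at hcon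
    have hle : ∀ n, jumpTime t (n + 1) w ≤ (s : EReal) := fun n => not_lt.1 (hcon n)
    have hlt : ∀ n, jumpTime t (n + 1) w ≠ ⊤ := fun n =>
      ne_top_of_le_ne_top (EReal.coe_ne_top s) (hle n)
    have hex : ∀ n, ∃ r : unitInterval, jumpTime t (n + 1) w = ((r : ℝ) : EReal) ∧
        jumpTime t n w < ((r : ℝ) : EReal) ∧ IsJump w.1 r := fun n =>
      (jumpTime_succ_eq_top_or t n w).resolve_left (hlt n)
    choose r hr _ hrj using hex
    have hmono : StrictMono fun n => jumpTime t (n + 1) w :=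
      strictMono_nat_of_lt_succ fun n => jumpTime_lt_succ (hlt n)
    have hinj : Function.Injective r := fun a b hab =>
      hmono.injective (by simp only [hr, hab])
    exact infinite_of_injective_forall_mem hinj hrj w.2.finite_jumps
  exact Nat.sInf_mem hne

theorem jumpTime_jumpCount_le {t s : ℝ} (hts : t ≤ s) (w : PathSpace G) :
    jumpTime t (jumpCount t s w) w ≤ (s : EReal) := by
  rcases Nat.eq_zero_or_pos (jumpCount t s w) with h | h
  · rw [h]; exact EReal.coe_le_coe_iff.2 hts
  · obtain ⟨n, hn⟩ := Nat.exists_eq_succ_of_ne_zero h.ne'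
    rw [hn]
    refine not_lt.1 fun hlt => ?_
    have : jumpCount t s w ≤ n := Nat.sInf_le hlt
    omega

theorem jumpCount_eq {t s : ℝ} {n : ℕ} {w : PathSpace G} (h1 : jumpTime t n w ≤ (s : EReal))
    (h2 : (s : EReal) < jumpTime t (n + 1) w) : jumpCount t s w = n := by
  refine le_antisymm (Nat.sInf_le h2) (not_lt.1 fun hlt => ?_)
  exact absurd ((jumpTime_mono t w (Nat.succ_le_of_lt hlt)).trans h1)
    (not_le.2 (lt_jumpTime_jumpCount_succ t s w))

theorem head?_skeleton {t s : ℝ} (ht : 0 ≤ t) (hts : t ≤ s) (hs : s ≤ 1) (w : PathSpace G) :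
    (skeleton t s w).head? = some (pos s w) := by
  rw [skeleton, head?_history, pos_eq_of_jumpTime_le ht hs (jumpTime_jumpCount_le hts w)
    (lt_jumpTime_jumpCount_succ t s w)]

theorem pos_of_skeleton_eq_history {t s : ℝ} {w : PathSpace G} {f : ℕ → V} {n : ℕ}
    (h : skeleton t s w = history f n) :
    jumpCount t s w = n ∧ ∀ i ≤ n, pos (jumpTime t i w).toReal w = f i := by
  have hl := congrArg List.length h
  rw [skeleton, length_history, length_history] at hl
  have hn : jumpCount t s w = n := by omega
  refine ⟨hn, ?_⟩
  rw [skeleton, hn] at h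
  exact (history_eq_iff _ _ _).1 h

open Classical in
/-- The states seen at the times `t, t + δ, …, t + i δ`, consecutive repetitions removed, the most
recent one first. -/
noncomputable def trail (t δ : ℝ) (w : PathSpace G) : ℕ → List V
  | 0 => [pos t w]
  | i + 1 =>
      if (trail t δ w i).head? = some (pos (t + (i + 1 : ℕ) * δ) w) then trail t δ w i
      else pos (t + (i + 1 : ℕ) * δ) w :: trail t δ w i

theorem head?_trail (t δ : ℝ) (w : PathSpace G) (i : ℕ) :
    (trail t δ w i).head? = some (pos (t + i * δ) w) := by
  cases i with
  | zero => simp [trail]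
  | succ i =>
    rw [trail]
    split_ifs with h
    · exact h
    · rfl

/-- On a fine grid the discretely observed path shows exactly the visited states. -/
theorem eventually_trail_eq_skeleton {t s : ℝ} (ht : 0 ≤ t) (hts : t ≤ s) (hs : s ≤ 1)
    (w : PathSpace G) :
    ∀ᶠ m : ℕ in atTop, trail t ((s - t) / m) w m = skeleton t s w := by
  set n := jumpCount t s w with hn
  set T : ℕ → ℝ := fun k => (jumpTime t k w).toReal with hT
  have hTle : ∀ k ≤ n, jumpTime t k w ≤ (s : EReal) := fun k hk =>
    (jumpTime_mono t w hk).trans (jumpTime_jumpCount_le hts w)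
  have hTc : ∀ k ≤ n, ((T k : ℝ) : EReal) = jumpTime t k w := fun k hk =>
    coe_toReal_jumpTime (hTle k hk)
  have hTlt : ∀ k < n, 0 < T (k + 1) - T k := by
    intro k hk
    rw [sub_pos, ← EReal.coe_lt_coe_iff, hTc k hk.le, hTc (k + 1) hk]
    exact jumpTime_lt_succ (ne_top_of_le_ne_top (EReal.coe_ne_top s) (hTle k hk.le))
  have hgap : ∀ᶠ m : ℕ in atTop, ∀ k ∈ Finset.range n, (s - t) / m < T (k + 1) - T k := by
    rw [eventually_all_finset]
    intro k hk
    exact (tendsto_const_div_atTop_nhds_zero_nat (s - t)).eventually_lt_const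
      (hTlt k (Finset.mem_range.1 hk))
  filter_upwards [hgap, eventually_gt_atTop 0] with m hm hm0
  have hm0' : (0 : ℝ) < m := by exact_mod_cast hm0
  set δ := (s - t) / m with hδ
  have hδ0 : 0 ≤ δ := div_nonneg (sub_nonneg.2 hts) hm0'.le
  have hmδ : t + m * δ = s := by rw [hδ]; field_simp; ring
  -- The mesh is smaller than all gaps between jumps in `(t, s]`, so each step of the grid crosses
  -- at most one jump.
  have key : ∀ i ≤ m, ∃ k ≤ n, jumpTime t k w ≤ ((t + i * δ : ℝ) : EReal) ∧
      ((t + i * δ : ℝ) : EReal) < jumpTime t (k + 1) w ∧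
      trail t δ w i = history (fun k => pos (T k) w) k := by
    intro i
    induction i with
    | zero =>
      intro _
      refine ⟨0, Nat.zero_le _, ?_, ?_, ?_⟩
      · simp [jumpTime]
      · have : jumpTime t 0 w < jumpTime t 1 w := jumpTime_lt_succ (EReal.coe_ne_top t)
        simpa [jumpTime] using this
      · simp [trail, history, hT, jumpTime]
    | succ i ih =>
      intro hi
      obtain ⟨k, hk, h1, h2, h3⟩ := ih (by omega)
      have hile : t + (i + 1 : ℕ) * δ ≤ s := by
        rw [← hmδ]
        have : ((i + 1 : ℕ) : ℝ) ≤ m := by exact_mod_cast hi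
        gcongr
      have hstep : t + (i + 1 : ℕ) * δ = t + i * δ + δ := by push_cast; ring
      have hle : t + i * δ ≤ t + (i + 1 : ℕ) * δ := by linarith
      rcases lt_or_ge ((t + (i + 1 : ℕ) * δ : ℝ) : EReal) (jumpTime t (k + 1) w) with hlt | hge
      · have h1' := h1.trans (EReal.coe_le_coe_iff.2 hle)
        refine ⟨k, hk, h1', hlt, ?_⟩
        have hp := pos_eq_of_jumpTime_le ht (hile.trans hs) h1' hlt
        rw [trail, h3, head?_history, if_pos (by rw [hp])]
      · have hkn : k + 1 ≤ n := by
          by_contra hcon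
          have : k = n := by omega
          subst this
          exact absurd (hge.trans (EReal.coe_le_coe_iff.2 hile))
            (not_le.2 (lt_jumpTime_jumpCount_succ t s w))
        have hlt : ((t + (i + 1 : ℕ) * δ : ℝ) : EReal) < jumpTime t (k + 1 + 1) w := by
          rcases Nat.lt_or_ge (k + 1) n with hk2 | hk2
          · have hg := hm (k + 1) (Finset.mem_range.2 hk2)
            rw [← hTc (k + 1) hkn, EReal.coe_lt_coe_iff] at h2
            rw [← hTc (k + 1 + 1) hk2, EReal.coe_lt_coe_iff]
            linarith
          · have : k + 1 = n := le_antisymm hkn hk2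
            rw [this]
            exact (EReal.coe_le_coe_iff.2 hile).trans_lt (lt_jumpTime_jumpCount_succ t s w)
        refine ⟨k + 1, hkn, hge, hlt, ?_⟩
        have hp := pos_eq_of_jumpTime_le ht (hile.trans hs) hge hlt
        have hne : pos (T (k + 1)) w ≠ pos (T k) w := pos_jumpTime_succ_ne ht
          (ne_top_of_le_ne_top (EReal.coe_ne_top s) (hTle _ hkn))
        rw [trail, h3, head?_history, if_neg, hp]
        · rfl
        · rw [hp]; simpa using fun h => hne h.symm
  obtain ⟨k, hk, h1, h2, h3⟩ := key m le_rfl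
  rw [hmδ] at h1 h2
  rw [h3, skeleton, jumpCount_eq h1 h2]

theorem skeleton_eq_singleton_iff {t s : ℝ} (hts : t ≤ s) (w : PathSpace G) (a : V) :
    skeleton t s w = [a] ↔ pos t w = a ∧ (s : EReal) < jumpTime t 1 w := by
  constructor
  · intro h
    obtain ⟨h1, h2⟩ := pos_of_skeleton_eq_history (f := fun _ => a) (n := 0) h
    refine ⟨by simpa [jumpTime] using h2 0 le_rfl, ?_⟩
    simpa [h1] using lt_jumpTime_jumpCount_succ t s w
  · rintro ⟨h1, h2⟩
    have h0 : jumpTime t 0 w ≤ (s : EReal) := EReal.coe_le_coe_iff.2 hts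
    rw [skeleton, jumpCount_eq h0 h2]
    simp [history, jumpTime, h1]

theorem skeleton_eq_pair_iff {t s : ℝ} (ht : 0 ≤ t) (hts : t ≤ s) (hs : s ≤ 1) (w : PathSpace G)
    {z z' : V} (hz : z ≠ z') :
    skeleton t s w = [z', z] ↔
      pos t w = z ∧ pos s w = z' ∧ (s : EReal) < jumpTime t 2 w := by
  constructor
  · intro h
    have hh := head?_skeleton ht hts hs w
    rw [h] at hh
    obtain ⟨h1, h2⟩ := pos_of_skeleton_eq_history (f := fun k => if k = 0 then z else z')
      (n := 1) h
    refine ⟨by simpa [jumpTime] using h2 0 (by simp), by simpa using hh.symm, ?_⟩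
    simpa [h1] using lt_jumpTime_jumpCount_succ t s w
  · rintro ⟨h1, h2, h3⟩
    have h0 : jumpTime t 0 w ≤ (s : EReal) := EReal.coe_le_coe_iff.2 hts
    have h4 : jumpTime t 1 w ≤ (s : EReal) := by
      refine not_lt.1 fun hlt => hz ?_
      rw [← h1, ← h2, pos_eq_of_jumpTime_le ht hs h0 hlt]
      simp [jumpTime]
    have h5 := pos_eq_of_jumpTime_le ht hs h4 h3
    rw [skeleton, jumpCount_eq h4 h3]
    simp only [history, List.cons.injEq, and_true]
    exact ⟨by rw [← h2, h5], by simpa [jumpTime] using h1⟩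

/-- A single jump in `(t, s]` that falls in `(t, u]` is a jump in `(t, u]` followed by rest on
`[u, s]`. -/
theorem skeleton_pair_and_jumpTime_le_iff {t u s : ℝ} (ht : 0 ≤ t) (htu : t ≤ u) (hus : u ≤ s)
    (hs : s ≤ 1) (w : PathSpace G) {z z' : V} (hz : z ≠ z') :
    (skeleton t s w = [z', z] ∧ jumpTime t 1 w ≤ (u : EReal)) ↔
      (skeleton t u w = [z', z] ∧ skeleton u s w = [z']) := by
  rw [skeleton_eq_pair_iff ht (htu.trans hus) hs w hz, skeleton_eq_pair_iff ht htu (hus.trans hs) w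
    hz, skeleton_eq_singleton_iff hus]
  have hus' : (u : EReal) ≤ s := EReal.coe_le_coe_iff.2 hus
  constructor
  · rintro ⟨⟨h1, h2, h3⟩, h4⟩
    have hu2 := hus'.trans_lt h3
    have hpu : pos u w = z' := by
      rw [← h2, pos_eq_of_jumpTime_le ht (hus.trans hs) h4 hu2,
        pos_eq_of_jumpTime_le ht hs (h4.trans hus') h3]
    refine ⟨⟨h1, hpu, hu2⟩, hpu, ?_⟩
    refine not_le.1 fun hle => ?_
    rcases jumpTime_succ_eq_top_or u 0 w with h | ⟨r, hr1, hr2, hr3⟩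
    · rw [show jumpTime u 1 w = ⊤ from h] at hle
      exact absurd hle (not_le.2 (EReal.coe_lt_top s))
    · have h5 := jumpTime_succ_le hr3 (h4.trans_lt hr2)
      rw [← hr1] at h5
      exact absurd (h5.trans hle) (not_le.2 h3)
  · rintro ⟨⟨h1, h2, h3⟩, h4, h5⟩
    have h6 : jumpTime t 1 w ≤ (u : EReal) := by
      refine not_lt.1 fun hlt => hz ?_
      have h0 : jumpTime t 0 w ≤ (u : EReal) := EReal.coe_le_coe_iff.2 htu
      rw [← h1, ← h2, pos_eq_of_jumpTime_le ht (hus.trans hs) h0 hlt]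
      simp [jumpTime]
    have h7 : (s : EReal) < jumpTime t 2 w := by
      rcases jumpTime_succ_eq_top_or t 1 w with h | ⟨r, hr1, hr2, hr3⟩
      · rw [show jumpTime t 2 w = ⊤ from h]
        exact EReal.coe_lt_top s
      · rw [show jumpTime t 2 w = ((r : ℝ) : EReal) from hr1] at h3 ⊢
        exact h5.trans_le (jumpTime_succ_le (k := 0) hr3 h3)
    have hp : pos s w = z' := by
      rw [← h2, pos_eq_of_jumpTime_le ht (hus.trans hs) h6 h3,
        pos_eq_of_jumpTime_le ht hs (h6.trans hus') h7]
    exact ⟨⟨h1, hp, h7⟩, h6⟩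

/-- A jump at time `s` is seen in the skeleton over every interval `[r, s]` with `r < s`. -/
theorem skeleton_ne_singleton_of_isJump {r s : ℝ} (hrs : r < s) (hs : s ∈ Icc (0 : ℝ) 1)
    {w : PathSpace G} (hj : IsJump w.1 ⟨s, hs⟩) (a : V) : skeleton r s w ≠ [a] := by
  intro h
  rw [skeleton_eq_singleton_iff hrs.le] at h
  have : jumpTime r 0 w < ((s : ℝ) : EReal) := EReal.coe_lt_coe_iff.2 hrs
  exact absurd (jumpTime_succ_le (s := ⟨s, hs⟩) hj this) (not_le.2 h.2)

/-- The event of following a prescribed sequence of states with its last jump strictly before `s`,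
in terms of the skeleton. -/
theorem follows_iff_skeleton {t s : ℝ} (hts : t < s) (hs : s ∈ Icc (0 : ℝ) 1)
    (w : PathSpace G) (f : ℕ → V) (n : ℕ) (hj : ¬ IsJump w.1 ⟨s, hs⟩) :
    ((∀ i ≤ n, pos (jumpTime t i w).toReal w = f i) ∧
      jumpTime t n w < (s : EReal) ∧ (s : EReal) < jumpTime t (n + 1) w) ↔
      skeleton t s w = history f n := by
  constructor
  · rintro ⟨h1, h2, h3⟩
    rw [skeleton, jumpCount_eq h2.le h3, history_eq_iff]
    exact h1
  · intro h
    obtain ⟨h1, h2⟩ := pos_of_skeleton_eq_history h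
    have h3 := jumpTime_jumpCount_le hts.le w
    have h4 := lt_jumpTime_jumpCount_succ t s w
    rw [h1] at h3 h4
    refine ⟨h2, lt_of_le_of_ne h3 fun he => ?_, h4⟩
    cases n with
    | zero => exact hts.ne (EReal.coe_injective he)
    | succ n =>
      rcases jumpTime_succ_eq_top_or t n w with h5 | ⟨r, hr1, hr2, hr3⟩
      · rw [h5] at he; exact absurd he.symm (EReal.coe_ne_top s)
      · rw [hr1] at he
        have : r = ⟨s, hs⟩ := Subtype.ext (EReal.coe_injective he)
        exact hj (this ▸ hr3)

end Paths

end RecipWalk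

/-! ### Measurability with respect to the past -/

namespace RecipWalk

section Past

variable {V : Type*} {G : SimpleGraph V}

/-- The canonical filtration at a real time; only times in `[0,1]` are meaningful. -/
@[reducible] noncomputable def past (G : SimpleGraph V) (t : ℝ) : MeasurableSpace (PathSpace G) :=
  canonicalFiltration G (projIcc 0 1 zero_le_one t)

theorem past_mono {s t : ℝ} (h : s ≤ t) : past G s ≤ past G t :=
  (canonicalFiltration G).mono (monotone_projIcc _ h)

theorem past_le (t : ℝ) : past G t ≤ instMeasurableSpacePathSpace G :=
  (canonicalFiltration G).le _

theorem measurableSet_past_pos_eq {r t : ℝ} (h : r ≤ t) (a : V) :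
    MeasurableSet[past G t] {w : PathSpace G | pos r w = a} := by
  refine past_mono h _ ?_
  have h1 : MeasurableSpace.comap (coord (G := G) (projIcc 0 1 zero_le_one r)) ⊤ ≤ past G r :=
    le_iSup₂_of_le (projIcc (0 : ℝ) 1 zero_le_one r) le_rfl le_rfl
  exact h1 _ ⟨{a}, trivial, rfl⟩

theorem measurableSet_pos_eq (t : ℝ) (a : V) :
    MeasurableSet {w : PathSpace G | pos t w = a} :=
  past_le t _ (measurableSet_past_pos_eq le_rfl a)

theorem trail_succ_eq_cons_iff (t δ : ℝ) (w : PathSpace G) (i : ℕ) (y : V) (l : List V) :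
    trail t δ w (i + 1) = y :: l ↔ pos (t + (i + 1 : ℕ) * δ) w = y ∧
      (trail t δ w i = y :: l ∨ (trail t δ w i = l ∧ l.head? ≠ some y)) := by
  rw [trail]
  split_ifs with h
  · constructor
    · intro hl
      rw [hl] at h
      exact ⟨by simpa using h.symm, Or.inl hl⟩
    · rintro ⟨h1, h2 | ⟨h2, h3⟩⟩
      · exact h2
      · rw [h2, h1] at h; exact absurd h h3
  · rw [List.cons.injEq]
    constructor
    · rintro ⟨h1, h2⟩
      exact ⟨h1, Or.inr ⟨h2, by rw [← h2, ← h1]; exact h⟩⟩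
    · rintro ⟨h1, h2 | ⟨h2, h3⟩⟩
      · exact absurd (by rw [h2, h1]; rfl) h
      · exact ⟨h1, h2⟩

theorem trail_ne_nil (t δ : ℝ) (w : PathSpace G) (i : ℕ) : trail t δ w i ≠ [] := by
  intro h
  have := head?_trail t δ w i
  simp [h] at this

theorem measurableSet_past_trail {t δ : ℝ} (hδ : 0 ≤ δ) (i : ℕ) (l : List V) :
    MeasurableSet[past G (t + i * δ)] {w : PathSpace G | trail t δ w i = l} := by
  induction i generalizing l with
  | zero =>
    by_cases h : ∃ a, l = [a]
    · obtain ⟨a, rfl⟩ := h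
      have h := measurableSet_past_pos_eq (G := G) (le_refl (t + (0 : ℕ) * δ)) a
      have he : t + ((0 : ℕ) : ℝ) * δ = t := by simp
      simp only [trail, List.cons.injEq, and_true]
      rw [he] at h ⊢
      exact h
    · have : {w : PathSpace G | trail t δ w 0 = l} = ∅ := by
        ext w; simpa [trail] using fun hl => h ⟨_, hl.symm⟩
      rw [this]; exact @MeasurableSet.empty _ (past G _)
  | succ i ih =>
    have hle : t + i * δ ≤ t + (i + 1 : ℕ) * δ := by push_cast; linarith
    cases l with
    | nil =>
      have : {w : PathSpace G | trail t δ w (i + 1) = []} = ∅ := by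
        ext w; simpa using trail_ne_nil t δ w (i + 1)
      rw [this]; exact @MeasurableSet.empty _ (past G _)
    | cons y l =>
      have : {w : PathSpace G | trail t δ w (i + 1) = y :: l} =
          {w | pos (t + (i + 1 : ℕ) * δ) w = y} ∩ ({w | trail t δ w i = y :: l} ∪
            ({w | trail t δ w i = l} ∩ {_w | l.head? ≠ some y})) := by
        ext w; exact trail_succ_eq_cons_iff t δ w i y l
      rw [this]
      refine MeasurableSet.inter (measurableSet_past_pos_eq le_rfl y) (MeasurableSet.union
        (past_mono hle _ (ih _)) (MeasurableSet.inter (past_mono hle _ (ih _)) ?_))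
      exact MeasurableSet.const _

theorem add_mul_div_le {t s : ℝ} (hts : t ≤ s) (m : ℕ) : t + m * ((s - t) / m) ≤ s := by
  rcases Nat.eq_zero_or_pos m with h | h
  · simpa [h] using hts
  · have : (m : ℝ) ≠ 0 := by positivity
    field_simp; linarith

theorem measurableSet_past_skeleton {t s : ℝ} (ht : 0 ≤ t) (hts : t ≤ s) (hs : s ≤ 1)
    (l : List V) : MeasurableSet[past G s] {w : PathSpace G | skeleton t s w = l} := by
  have : {w : PathSpace G | skeleton t s w = l} =
      ⋃ N : ℕ, ⋂ m : ℕ, ⋂ _ : N ≤ m, {w | trail t ((s - t) / m) w m = l} := by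
    ext w
    have h := eventually_trail_eq_skeleton ht hts hs w
    simp only [mem_iUnion, mem_iInter, mem_ofPred_eq, ← eventually_atTop]
    constructor
    · rintro rfl; exact h
    · intro h'
      obtain ⟨m, h1, h2⟩ := (h.and h').exists
      exact h1.symm.trans h2
  rw [this]
  refine MeasurableSet.iUnion fun N => MeasurableSet.iInter fun m => MeasurableSet.iInter fun _ =>
    past_mono (add_mul_div_le hts m) _ (measurableSet_past_trail ?_ m l)
  exact div_nonneg (sub_nonneg.2 hts) m.cast_nonneg

theorem tendsto_measureReal_trail {Q : Measure (PathSpace G)} [IsProbabilityMeasure Q]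
    {t s : ℝ} (ht : 0 ≤ t) (hts : t ≤ s) (hs : s ≤ 1) {B : Set (PathSpace G)}
    (hB : MeasurableSet B) (l : List V) :
    Tendsto (fun m : ℕ => Q.real (B ∩ {w | trail t ((s - t) / m) w m = l})) atTop
      (𝓝 (Q.real (B ∩ {w | skeleton t s w = l}))) := by
  refine (ENNReal.tendsto_toReal (measure_ne_top _ _)).comp ?_
  refine tendsto_measure_of_tendsto_indicator_of_isFiniteMeasure (L := atTop)
    (A := B ∩ {w | skeleton t s w = l}) Q (fun m => hB.inter (past_le _ _
      (measurableSet_past_trail (div_nonneg (sub_nonneg.2 hts) m.cast_nonneg) m l))) fun w => ?_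
  filter_upwards [eventually_trail_eq_skeleton ht hts hs w] with m hm
  simp [hm]

end Past

/-! ### Jump rates -/

section Rates

variable {V : Type*} (G : SimpleGraph V) (j : ℝ → V → V → ℝ)

open Classical in
/-- The jump intensity, put to zero off the arcs and frozen outside the time interval `[0,1]`, so
that it is a continuous function of time on the whole line. -/
noncomputable def rate (x y : V) (r : ℝ) : ℝ :=
  if G.Adj x y then j (projIcc (0 : ℝ) 1 zero_le_one r) x y else 0

/-- The total jump intensity, frozen outside the time interval `[0,1]`. -/
noncomputable def exitRate [G.LocallyFinite] (x : V) (r : ℝ) : ℝ :=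
  totalRate G j (projIcc (0 : ℝ) 1 zero_le_one r) x

open Classical in
/-- The generator applied to the indicator of `b`, at the state `a`. -/
noncomputable def netRate [G.LocallyFinite] (a b : V) (r : ℝ) : ℝ :=
  rate G j a b r - if a = b then exitRate G j b r else 0

variable {G j}

theorem rate_of_mem {x y : V} (h : G.Adj x y) {r : ℝ} (hr : r ∈ Icc (0 : ℝ) 1) :
    rate G j x y r = j r x y := by
  rw [rate, if_pos h, projIcc_of_mem _ hr]

theorem exitRate_of_mem [G.LocallyFinite] (x : V) {r : ℝ} (hr : r ∈ Icc (0 : ℝ) 1) :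
    exitRate G j x r = totalRate G j r x := by
  rw [exitRate, projIcc_of_mem _ hr]

theorem rate_self (x : V) (r : ℝ) : rate G j x x r = 0 := by simp [rate]

theorem continuous_rate [G.LocallyFinite] (hj : IsAdmissibleIntensity G j)
    (x y : V) : Continuous (rate G j x y) := by
  unfold rate
  split_ifs with h
  · exact ((hj.contDiff x y h).continuousOn.domRestrict).comp continuous_projIcc
  · exact continuous_const

theorem continuous_exitRate [G.LocallyFinite] (hj : IsAdmissibleIntensity G j)
    (x : V) : Continuous (exitRate G j x) := by
  unfold exitRate totalRate
  refine continuous_finsetSum _ fun y hy => ?_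
  rw [SimpleGraph.mem_neighborFinset] at hy
  exact ((hj.contDiff x y hy).continuousOn.domRestrict).comp continuous_projIcc

theorem rate_nonneg [G.LocallyFinite] (hj : IsAdmissibleIntensity G j)
    (x y : V) (r : ℝ) : 0 ≤ rate G j x y r := by
  unfold rate
  split_ifs with h
  · exact (hj.pos _ (projIcc (0 : ℝ) 1 zero_le_one r).2 x y h).le
  · exact le_rfl

theorem rate_pos [G.LocallyFinite] (hj : IsAdmissibleIntensity G j)
    {x y : V} (h : G.Adj x y) (r : ℝ) : 0 < rate G j x y r := by
  rw [rate, if_pos h]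
  exact hj.pos _ (projIcc (0 : ℝ) 1 zero_le_one r).2 x y h

theorem rate_le_exitRate [G.LocallyFinite] (hj : IsAdmissibleIntensity G j)
    (x y : V) (r : ℝ) : rate G j x y r ≤ exitRate G j x r := by
  have hnn : ∀ z ∈ G.neighborFinset x, 0 ≤ j (projIcc (0 : ℝ) 1 zero_le_one r) x z := fun z hz =>
    (hj.pos _ (projIcc (0 : ℝ) 1 zero_le_one r).2 x z (by simpa using hz)).le
  unfold rate
  split_ifs with h
  · exact Finset.single_le_sum hnn (by simpa using h)
  · exact Finset.sum_nonneg hnn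

theorem exitRate_nonneg [G.LocallyFinite] (hj : IsAdmissibleIntensity G j)
    (x : V) (r : ℝ) : 0 ≤ exitRate G j x r :=
  (rate_nonneg hj x x r).trans (rate_le_exitRate hj x x r)

theorem exitRate_le [G.LocallyFinite] {C : ℝ}
    (hC : ∀ t ∈ Icc (0 : ℝ) 1, ∀ z, totalRate G j t z ≤ C) (x : V) (r : ℝ) : exitRate G j x r ≤ C := hC _ (projIcc (0 : ℝ) 1 zero_le_one r).2 x

theorem continuous_netRate [G.LocallyFinite] (hj : IsAdmissibleIntensity G j)
    (a b : V) : Continuous (netRate G j a b) := by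
  unfold netRate
  split_ifs
  · exact (continuous_rate hj a b).sub (continuous_exitRate hj b)
  · exact (continuous_rate hj a b).sub continuous_const

theorem abs_netRate_le [G.LocallyFinite] (hj : IsAdmissibleIntensity G j)
    {C : ℝ} (hC : ∀ t ∈ Icc (0 : ℝ) 1, ∀ z, totalRate G j t z ≤ C) (a b : V)
    (r : ℝ) : |netRate G j a b r| ≤ C := by
  unfold netRate
  split_ifs with h
  · subst h
    rw [rate_self, zero_sub, abs_neg, abs_of_nonneg (exitRate_nonneg hj a r)]
    exact exitRate_le hC a r
  · rw [sub_zero, abs_of_nonneg (rate_nonneg hj a b r)]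
    exact (rate_le_exitRate hj a b r).trans (exitRate_le hC a r)

open Classical in
theorem generator_single [G.LocallyFinite] {r : ℝ} (hr : r ∈ Icc (0 : ℝ) 1) (a b : V) :
    generator G j r (Pi.single b 1) a = netRate G j a b r := by
  have h1 : generator G j r (Pi.single b 1) a =
      (∑ z ∈ G.neighborFinset a, j r a z * (Pi.single b (1 : ℝ) : V → ℝ) z) -
        totalRate G j r a * (Pi.single b (1 : ℝ) : V → ℝ) a := by
    simp only [generator, totalRate, mul_sub, Finset.sum_sub_distrib, Finset.sum_mul]
  rw [h1, netRate]
  congr 1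
  · by_cases h : G.Adj a b
    · rw [rate_of_mem h hr, Finset.sum_eq_single b]
      · simp
      · intro z _ hz; simp [Pi.single_eq_of_ne hz]
      · intro hb; simp [h] at hb
    · rw [rate, if_neg h]
      refine Finset.sum_eq_zero fun z hz => ?_
      have : z ≠ b := by rintro rfl; exact h (by simpa using hz)
      simp [Pi.single_eq_of_ne this]
  · split_ifs with h
    · subst h; simp [exitRate_of_mem a hr]
    · simp [Pi.single_eq_of_ne h]

end Rates

end RecipWalk

/-! ### Short-time estimates from the martingale problem -/

namespace RecipWalk

section OneStep

variable {V : Type*} {G : SimpleGraph V} [G.LocallyFinite] {j : ℝ → V → V → ℝ}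

open Classical in
theorem abs_generator_single_le (hj : IsAdmissibleIntensity G j) {C : ℝ}
    (hC : ∀ t ∈ Icc (0 : ℝ) 1, ∀ z, totalRate G j t z ≤ C) {r : ℝ} (hr : r ∈ Icc (0 : ℝ) 1)
    (b : V) (w : PathSpace G) : |generator G j r (Pi.single b 1) (pos r w)| ≤ C := by
  rw [generator_single hr]; exact abs_netRate_le hj hC _ b r

open Classical in
/-- Away from the finitely many jump times the integrand is locally a continuous function. -/
theorem integrableOn_generator_single (hj : IsAdmissibleIntensity G j) (b : V) (w : PathSpace G) :
    IntegrableOn (fun r => generator G j r (Pi.single b 1) (pos r w)) (Icc (0 : ℝ) 1) := by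
  obtain ⟨C, hC⟩ := hj.bounded
  set J : Set ℝ := Subtype.val '' {s : unitInterval | IsJump w.1 s} ∪ {0, 1} with hJ
  have hJf : J.Finite := (w.2.finite_jumps.image _).union (by simp)
  set A : Set ℝ := Icc (0 : ℝ) 1 \ J with hA
  have hAm : MeasurableSet A := measurableSet_Icc.diff hJf.measurableSet
  have hcont : ContinuousOn (fun r => generator G j r (Pi.single b 1) (pos r w)) A := by
    intro r hr
    have hr01 : r ∈ Icc (0 : ℝ) 1 := hr.1
    have hnj : ¬ IsJump w.1 ⟨r, hr01⟩ := fun h => hr.2 (Or.inl ⟨_, h, rfl⟩)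
    have hev : ∀ᶠ x in 𝓝[A] r, pos x w = pos r w := by
      have h1 : Tendsto (projIcc (0 : ℝ) 1 zero_le_one) (𝓝[A] r) (𝓝 ⟨r, hr01⟩) := by
        have := (continuous_projIcc (h := zero_le_one' ℝ)).tendsto r
        rw [projIcc_of_mem _ hr01] at this
        exact this.mono_left nhdsWithin_le_nhds
      have h2 := h1.eventually (eventually_nhds_eq w hnj)
      filter_upwards [h2] with x hx
      rw [pos_of_mem hr01]; exact hx
    have h3 : ContinuousWithinAt (netRate G j (pos r w) b) A r :=
      (continuous_netRate hj _ b).continuousWithinAt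
    refine h3.congr_of_eventuallyEq ?_ (generator_single hr01 _ b)
    filter_upwards [hev, self_mem_nhdsWithin] with x hx hxA
    rw [generator_single hxA.1, hx]
  have hint : IntegrableOn (fun r => generator G j r (Pi.single b 1) (pos r w)) A := by
    refine ⟨hcont.aestronglyMeasurable hAm, ?_⟩
    refine HasFiniteIntegral.restrict_of_bounded C ?_ ?_
    · exact (measure_mono (sdiff_subset)).trans_lt (by simp)
    · filter_upwards [ae_restrict_mem hAm] with r hr
      exact abs_generator_single_le hj hC hr.1 b w
  exact hint.congr_set_ae (sdiff_null_ae_eq_self (hJf.measure_zero _)).symm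

variable {x : V} {Q : Measure (PathSpace G)}

open Classical in
/-- Dynkin's formula for the indicator of a state, on an event of the past. -/
theorem SolvesMartingaleProblem.measureReal_sub (hj : IsAdmissibleIntensity G j)
    (hQ : SolvesMartingaleProblem G j x Q) {t s : ℝ} (ht : 0 ≤ t) (hts : t ≤ s) (hs : s ≤ 1)
    {B : Set (PathSpace G)} (hB : MeasurableSet[past G t] B) (b : V) :
    Integrable (fun w => ∫ r in t..s, generator G j r (Pi.single b 1) (pos r w)) Q ∧
    Q.real (B ∩ {w | pos s w = b}) - Q.real (B ∩ {w | pos t w = b}) =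
      ∫ w in B, (∫ r in t..s, generator G j r (Pi.single b 1) (pos r w)) ∂Q := by
  have := hQ.isProb
  have hBm : MeasurableSet B := past_le t _ hB
  set u : V → ℝ := Pi.single b 1 with hu
  have hus : (Function.support u).Finite :=
    (finite_singleton b).subset (by rw [hu]; exact Pi.support_single_subset)
  have hM := hQ.martingale u hus
  set pt : unitInterval := projIcc 0 1 zero_le_one t with hpt
  set ps : unitInterval := projIcc 0 1 zero_le_one s with hps
  have hptv : (pt : ℝ) = t := by rw [hpt, projIcc_of_mem _ ⟨ht, hts.trans hs⟩]
  have hpsv : (ps : ℝ) = s := by rw [hps, projIcc_of_mem _ ⟨ht.trans hts, hs⟩]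
  have hle : pt ≤ ps := monotone_projIcc _ hts
  have hset := hM.setIntegral_eq hle hB
  have hIt := hM.integrable pt
  have hIs := hM.integrable ps
  have hind : ∀ r : ℝ, (fun w : PathSpace G => u (pos r w)) =
      ({w : PathSpace G | pos r w = b}).indicator 1 := by
    intro r; ext w
    by_cases h : pos r w = b
    · simp [hu, h]
    · simp [hu, h]
  have hui : ∀ r : ℝ, Integrable (fun w : PathSpace G => u (pos r w)) Q := by
    intro r
    rw [hind]
    exact (integrable_const (1 : ℝ)).indicator (measurableSet_pos_eq r b)
  have huv : ∀ r : ℝ, ∫ w in B, u (pos r w) ∂Q = Q.real (B ∩ {w | pos r w = b}) := by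
    intro r
    rw [hind, setIntegral_indicator (measurableSet_pos_eq r b)]
    simp
  have hIt' : Integrable (fun w => ∫ r in (0 : ℝ)..t, generator G j r u (pos r w)) Q := by
    refine ((hui t).sub hIt).congr (ae_of_all _ fun w => ?_)
    simp only [Pi.sub_apply, hptv]
    rw [show coord pt w = pos t w from rfl]; ring
  have hIs' : Integrable (fun w => ∫ r in (0 : ℝ)..s, generator G j r u (pos r w)) Q := by
    refine ((hui s).sub hIs).congr (ae_of_all _ fun w => ?_)
    simp only [Pi.sub_apply, hpsv]
    rw [show coord ps w = pos s w from rfl]; ring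
  have hsub : ∀ w : PathSpace G, ∫ r in t..s, generator G j r u (pos r w) =
      (∫ r in (0 : ℝ)..s, generator G j r u (pos r w)) -
        ∫ r in (0 : ℝ)..t, generator G j r u (pos r w) := by
    intro w
    have hI := integrableOn_generator_single hj b w
    refine (intervalIntegral.integral_interval_sub_left ?_ ?_).symm
    · exact (intervalIntegrable_iff_integrableOn_Icc_of_le (ht.trans hts)).2
        (hI.mono_set (Icc_subset_Icc_right hs))
    · exact (intervalIntegrable_iff_integrableOn_Icc_of_le ht).2
        (hI.mono_set (Icc_subset_Icc_right (hts.trans hs)))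
  have hI2 : Integrable (fun w => ∫ r in t..s, generator G j r u (pos r w)) Q :=
    (hIs'.sub hIt').congr (ae_of_all _ fun w => (hsub w).symm)
  refine ⟨hI2, ?_⟩
  simp only [hptv, hpsv] at hset
  change ∫ w in B, (u (pos t w) - _) ∂Q = ∫ w in B, (u (pos s w) - _) ∂Q at hset
  rw [integral_sub (hui t).integrableOn hIt'.integrableOn,
    integral_sub (hui s).integrableOn hIs'.integrableOn, huv, huv] at hset
  rw [integral_congr_ae (ae_of_all _ hsub),
    integral_sub hIs'.integrableOn hIt'.integrableOn]
  linarith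

variable {C : ℝ}

theorem SolvesMartingaleProblem.abs_measureReal_sub_le (hj : IsAdmissibleIntensity G j)
    (hC : ∀ t ∈ Icc (0 : ℝ) 1, ∀ z, totalRate G j t z ≤ C)
    (hQ : SolvesMartingaleProblem G j x Q) {t s : ℝ} (ht : 0 ≤ t) (hts : t ≤ s) (hs : s ≤ 1)
    {B : Set (PathSpace G)} (hB : MeasurableSet[past G t] B) (b : V) :
    |Q.real (B ∩ {w | pos s w = b}) - Q.real (B ∩ {w | pos t w = b})| ≤
      C * (s - t) * Q.real B := by
  classical
  have := hQ.isProb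
  rw [(hQ.measureReal_sub hj ht hts hs hB b).2, ← Real.norm_eq_abs]
  refine norm_setIntegral_le_of_norm_le_const (measure_lt_top _ _) fun w _ => ?_
  rw [← abs_of_nonneg (sub_nonneg.2 hts)]
  refine intervalIntegral.norm_integral_le_of_norm_le_const fun r hr => ?_
  rw [uIoc_of_le hts] at hr
  exact abs_generator_single_le hj hC ⟨ht.trans hr.1.le, hr.2.trans hs⟩ b w

theorem SolvesMartingaleProblem.le_measureReal_trail_singleton (hj : IsAdmissibleIntensity G j)
    (hC : ∀ t ∈ Icc (0 : ℝ) 1, ∀ z, totalRate G j t z ≤ C)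
    (hQ : SolvesMartingaleProblem G j x Q) {t δ : ℝ} (ht : 0 ≤ t) (hδ : 0 ≤ δ)
    {B : Set (PathSpace G)} (hB : MeasurableSet[past G t] B) {a : V} (hBa : ∀ w ∈ B, pos t w = a)
    (i : ℕ) (hi : t + i * δ ≤ 1) :
    (1 - C * (i * δ)) * Q.real B ≤ Q.real (B ∩ {w | trail t δ w i = [a]}) := by
  have := hQ.isProb
  have hC0 : 0 ≤ C := (exitRate_nonneg hj x 0).trans (exitRate_le hC x 0)
  induction i with
  | zero =>
    have : B ∩ {w | trail t δ w 0 = [a]} = B :=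
      inter_eq_left.2 fun w hw => by simpa [trail] using hBa w hw
    rw [this]; simp
  | succ i ih =>
    have hstep : t + (i + 1 : ℕ) * δ = t + i * δ + δ := by push_cast; ring
    have hiδ : 0 ≤ (i : ℝ) * δ := mul_nonneg i.cast_nonneg hδ
    have ih' := ih (by linarith)
    set Bi := B ∩ {w | trail t δ w i = [a]} with hBi
    have hBim : MeasurableSet[past G (t + i * δ)] Bi :=
      (past_mono (by linarith) _ hB).inter (measurableSet_past_trail hδ i _)
    have h1 := hQ.abs_measureReal_sub_le hj hC (by linarith) (by linarith : t + i * δ ≤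
      t + (i + 1 : ℕ) * δ) hi hBim a
    have h2 : Bi ∩ {w | pos (t + i * δ) w = a} = Bi := inter_eq_left.2 fun w hw => by
      have := head?_trail t δ w i
      rw [show trail t δ w i = [a] from hw.2] at this
      simpa using this.symm
    have h3 : Bi ∩ {w | pos (t + (i + 1 : ℕ) * δ) w = a} ⊆
        B ∩ {w | trail t δ w (i + 1) = [a]} := fun w hw =>
      ⟨hw.1.1, (trail_succ_eq_cons_iff t δ w i a []).2 ⟨hw.2, Or.inl hw.1.2⟩⟩
    have h4 := measureReal_mono (μ := Q) h3
    have h5 : Q.real Bi ≤ Q.real B := measureReal_mono inter_subset_left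
    rw [h2, hstep] at h1
    rw [hstep] at h4
    have h6 := (abs_le.1 h1).1
    have h7 : C * (t + i * δ + δ - (t + i * δ)) * Q.real Bi ≤ C * δ * Q.real B := by
      rw [add_sub_cancel_left]; gcongr
    push_cast
    nlinarith

/-- The probability of a jump in `(t, s]` is at most `C (s - t)`. -/
theorem SolvesMartingaleProblem.measureReal_diff_skeleton_le (hj : IsAdmissibleIntensity G j)
    (hC : ∀ t ∈ Icc (0 : ℝ) 1, ∀ z, totalRate G j t z ≤ C)
    (hQ : SolvesMartingaleProblem G j x Q) {t s : ℝ} (ht : 0 ≤ t) (hts : t ≤ s) (hs : s ≤ 1)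
    {B : Set (PathSpace G)} (hB : MeasurableSet[past G t] B) {a : V}
    (hBa : ∀ w ∈ B, pos t w = a) :
    Q.real (B \ {w | skeleton t s w = [a]}) ≤ C * (s - t) * Q.real B := by
  have := hQ.isProb
  have hlim := tendsto_measureReal_trail (Q := Q) ht hts hs (past_le t _ hB) [a]
  have hle : (1 - C * (s - t)) * Q.real B ≤ Q.real (B ∩ {w | skeleton t s w = [a]}) := by
    refine ge_of_tendsto hlim ?_
    filter_upwards [eventually_gt_atTop 0] with m hm
    have hm' : (m : ℝ) ≠ 0 := by positivity
    have h := hQ.le_measureReal_trail_singleton hj hC ht (div_nonneg (sub_nonneg.2 hts)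
      m.cast_nonneg) hB hBa m ((add_mul_div_le hts m).trans hs)
    rwa [mul_div_cancel₀ _ hm'] at h
  have h := measureReal_inter_add_sdiff (μ := Q) (s := B)
    (past_le s _ (measurableSet_past_skeleton (G := G) ht hts hs [a]))
  linarith

open Classical in
/-- Transition probabilities over a short time, up to a uniform error of second order. -/
theorem SolvesMartingaleProblem.abs_measureReal_sub_transition_le (hj : IsAdmissibleIntensity G j)
    (hC : ∀ t ∈ Icc (0 : ℝ) 1, ∀ z, totalRate G j t z ≤ C)
    (hQ : SolvesMartingaleProblem G j x Q) {t s : ℝ} (ht : 0 ≤ t) (hts : t ≤ s) (hs : s ≤ 1)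
    {B : Set (PathSpace G)} (hB : MeasurableSet[past G t] B) {a : V}
    (hBa : ∀ w ∈ B, pos t w = a) (b : V) :
    |Q.real (B ∩ {w | pos s w = b}) -
      Q.real B * ((if a = b then 1 else 0) + ∫ r in t..s, netRate G j a b r)| ≤
      2 * C ^ 2 * (s - t) ^ 2 := by
  have := hQ.isProb
  have hC0 : 0 ≤ C := (exitRate_nonneg hj x 0).trans (exitRate_le hC x 0)
  have hts0 : 0 ≤ s - t := sub_nonneg.2 hts
  obtain ⟨hI, he⟩ := hQ.measureReal_sub hj ht hts hs hB b
  set N := {w : PathSpace G | skeleton t s w = [a]} with hN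
  have hNm : MeasurableSet N := past_le s _ (measurableSet_past_skeleton ht hts hs [a])
  have hBm := past_le t _ hB
  set g := ∫ r in t..s, netRate G j a b r with hg
  have h0 : Q.real (B ∩ {w | pos t w = b}) = Q.real B * (if a = b then 1 else 0) := by
    split_ifs with hab
    · have : B ∩ {w | pos t w = b} = B := inter_eq_left.2 fun w hw => (hBa w hw).trans hab
      rw [this, mul_one]
    · have : B ∩ {w | pos t w = b} = ∅ := by
        ext w; simp only [mem_inter_iff, mem_ofPred_eq, mem_empty_iff_false, iff_false]
        rintro ⟨h1, h2⟩; exact hab ((hBa w h1).symm.trans h2)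
      rw [this]; simp
  have h1 : Q.real (B ∩ {w | pos s w = b}) -
      Q.real B * ((if a = b then 1 else 0) + g) =
      ∫ w in B, ((∫ r in t..s, generator G j r (Pi.single b 1) (pos r w)) - g) ∂Q := by
    rw [integral_sub hI.integrableOn (integrable_const g).integrableOn, ← he, h0]
    rw [integral_const, measureReal_restrict_apply_univ, smul_eq_mul]
    ring
  -- The integrand is deterministic on the paths without jumps in `(t, s]`, and the others have
  -- probability `O(s - t)`.
  have h2 : ∫ w in B, ((∫ r in t..s, generator G j r (Pi.single b 1) (pos r w)) - g) ∂Q =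
      ∫ w in B \ N, ((∫ r in t..s, generator G j r (Pi.single b 1) (pos r w)) - g) ∂Q := by
    refine setIntegral_eq_of_subset_of_forall_sdiff_eq_zero hBm sdiff_subset ?_
    rintro w ⟨hwB, hw⟩
    have hwN : skeleton t s w = [a] := by
      by_contra h; exact hw ⟨hwB, h⟩
    rw [skeleton_eq_singleton_iff hts] at hwN
    rw [sub_eq_zero]
    refine intervalIntegral.integral_congr fun r hr => ?_
    rw [uIcc_of_le hts] at hr
    have hp : pos r w = a := by
      rw [← hwN.1, pos_eq_of_jumpTime_le ht (hr.2.trans hs) (k := 0)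
        (EReal.coe_le_coe_iff.2 hr.1) ((EReal.coe_le_coe_iff.2 hr.2).trans_lt hwN.2)]
      simp [jumpTime]
    simp only [hp]
    exact generator_single ⟨ht.trans hr.1, hr.2.trans hs⟩ a b
  have hg_le : |g| ≤ C * (s - t) := by
    rw [hg, ← abs_of_nonneg hts0, ← Real.norm_eq_abs]
    exact intervalIntegral.norm_integral_le_of_norm_le_const fun r _ =>
      abs_netRate_le hj hC a b r
  have h3 : |∫ w in B \ N, ((∫ r in t..s, generator G j r (Pi.single b 1) (pos r w)) - g) ∂Q| ≤
      (2 * C * (s - t)) * Q.real (B \ N) := by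
    rw [← Real.norm_eq_abs]
    refine norm_setIntegral_le_of_norm_le_const (measure_lt_top _ _) fun w _ => ?_
    have hw : |∫ r in t..s, generator G j r (Pi.single b 1) (pos r w)| ≤ C * (s - t) := by
      rw [← abs_of_nonneg hts0, ← Real.norm_eq_abs]
      refine intervalIntegral.norm_integral_le_of_norm_le_const fun r hr => ?_
      rw [uIoc_of_le hts] at hr
      exact abs_generator_single_le hj hC ⟨ht.trans hr.1.le, hr.2.trans hs⟩ b w
    rw [Real.norm_eq_abs]
    refine (abs_sub _ _).trans ?_
    linarith
  have h4 := hQ.measureReal_diff_skeleton_le hj hC ht hts hs hB hBa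
  have h5 : Q.real B ≤ 1 := measureReal_le_one
  have h6 : Q.real (B \ N) ≤ C * (s - t) :=
    h4.trans (mul_le_of_le_one_right (mul_nonneg hC0 hts0) h5)
  rw [h1, h2]
  calc _ ≤ (2 * C * (s - t)) * Q.real (B \ N) := h3
    _ ≤ (2 * C * (s - t)) * (C * (s - t)) := by gcongr
    _ = _ := by ring

end OneStep

end RecipWalk

/-! ### Probability of a prescribed sequence of states -/

namespace RecipWalk

section Weight

variable {V : Type*} (G : SimpleGraph V) (j : ℝ → V → V → ℝ)

/-- The intensity of a jump to `y` from the most recent state of the list `l`. -/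
noncomputable def arrivalRate (l : List V) (y : V) (r : ℝ) : ℝ :=
  match l with
  | [] => 0
  | x :: _ => rate G j x y r

variable [G.LocallyFinite]

open Classical in
/-- `walkWeight G j t a l s` is the probability that a walk of intensity `j` which is in `a` at
time `t` visits during `[t, s]` exactly the states in `l`, listed with the most recent one first.
It is given by iterating the variation of constants formula, see `hasDerivAt_walkWeight` for the
corresponding system of linear differential equations. -/
noncomputable def walkWeight (t : ℝ) (a : V) : List V → ℝ → ℝ
  | [] => fun _ => 0
  | y :: l => fun s => Real.exp (-∫ r in t..s, exitRate G j y r) *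
      ((if y :: l = [a] then 1 else 0) + ∫ r in t..s, walkWeight t a l r *
        arrivalRate G j l y r * Real.exp (∫ q in t..r, exitRate G j y q))

variable {G j}

theorem arrivalRate_nonneg (hj : IsAdmissibleIntensity G j) (l : List V) (y : V) (r : ℝ) :
    0 ≤ arrivalRate G j l y r := by
  cases l with
  | nil => exact le_rfl
  | cons x l => exact rate_nonneg hj x y r

theorem arrivalRate_le (hj : IsAdmissibleIntensity G j) {C : ℝ}
    (hC : ∀ t ∈ Icc (0 : ℝ) 1, ∀ z, totalRate G j t z ≤ C) (l : List V) (y : V) (r : ℝ) :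
    arrivalRate G j l y r ≤ C := by
  cases l with
  | nil => exact (exitRate_nonneg hj y r).trans (exitRate_le hC y r)
  | cons x l => exact (rate_le_exitRate hj x y r).trans (exitRate_le hC x r)

theorem continuous_arrivalRate (hj : IsAdmissibleIntensity G j) (l : List V) (y : V) :
    Continuous (arrivalRate G j l y) := by
  cases l with
  | nil => exact continuous_const
  | cons x l => exact continuous_rate hj x y

theorem hasDerivAt_integral_exitRate (hj : IsAdmissibleIntensity G j) (y : V) (t s : ℝ) :
    HasDerivAt (fun s => ∫ r in t..s, exitRate G j y r) (exitRate G j y s) s :=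
  ((continuous_exitRate hj y).integral_hasStrictDerivAt t s).hasDerivAt

theorem continuous_integral_exitRate (hj : IsAdmissibleIntensity G j) (y : V) (t : ℝ) :
    Continuous (fun s => ∫ r in t..s, exitRate G j y r) :=
  continuous_iff_continuousAt.2 fun s => (hasDerivAt_integral_exitRate hj y t s).continuousAt

theorem continuous_walkWeight (hj : IsAdmissibleIntensity G j) (t : ℝ) (a : V) (l : List V) :
    Continuous (walkWeight G j t a l) := by
  induction l with
  | nil => exact continuous_const
  | cons y l ih =>
    refine (Real.continuous_exp.comp (continuous_integral_exitRate hj y t).neg).mul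
      (continuous_const.add (continuous_iff_continuousAt.2 fun s => ?_))
    exact (((ih.mul (continuous_arrivalRate hj l y)).mul (Real.continuous_exp.comp
      (continuous_integral_exitRate hj y t))).integral_hasStrictDerivAt t s).hasDerivAt.continuousAt

open Classical in
theorem hasDerivAt_walkWeight (hj : IsAdmissibleIntensity G j) (t : ℝ) (a y : V) (l : List V)
    (s : ℝ) :
    HasDerivAt (walkWeight G j t a (y :: l)) (walkWeight G j t a l s * arrivalRate G j l y s -
      exitRate G j y s * walkWeight G j t a (y :: l) s) s := by
  have h1 := (hasDerivAt_integral_exitRate hj y t s).neg.exp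
  have h2 := ((((continuous_walkWeight hj t a l).mul (continuous_arrivalRate hj l y)).mul
    (Real.continuous_exp.comp (continuous_integral_exitRate hj y t))).integral_hasStrictDerivAt
      t s).hasDerivAt
  have h3 := h1.mul (h2.const_add (if y :: l = [a] then 1 else 0))
  refine h3.congr_deriv ?_
  have h4 : Real.exp (-∫ r in t..s, exitRate G j y r) * Real.exp (∫ r in t..s, exitRate G j y r)
      = 1 := by rw [← Real.exp_add]; simp
  simp only [walkWeight, Function.comp, Pi.neg_apply, Pi.mul_apply]
  linear_combination (walkWeight G j t a l s * arrivalRate G j l y s) * h4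

open Classical in
theorem walkWeight_self (t : ℝ) (a : V) (l : List V) :
    walkWeight G j t a l t = if l = [a] then 1 else 0 := by
  cases l with
  | nil => simp [walkWeight]
  | cons y l => simp [walkWeight]

theorem exists_lipschitz_walkWeight (hj : IsAdmissibleIntensity G j) (t : ℝ) (a : V)
    (l : List V) : ∃ L : ℝ, 0 ≤ L ∧ ∀ r ∈ Icc (0 : ℝ) 1, ∀ s ∈ Icc (0 : ℝ) 1,
      |walkWeight G j t a l s - walkWeight G j t a l r| ≤ L * |s - r| := by
  cases l with
  | nil => exact ⟨0, le_rfl, by simp [walkWeight]⟩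
  | cons y l =>
    have hc : Continuous fun s => walkWeight G j t a l s * arrivalRate G j l y s -
        exitRate G j y s * walkWeight G j t a (y :: l) s :=
      ((continuous_walkWeight hj t a l).mul (continuous_arrivalRate hj l y)).sub
        ((continuous_exitRate hj y).mul (continuous_walkWeight hj t a (y :: l)))
    obtain ⟨L, hL⟩ := isCompact_Icc.exists_bound_of_continuousOn (s := Icc (0 : ℝ) 1)
      hc.continuousOn
    refine ⟨L, (norm_nonneg _).trans (hL 0 (by simp)), fun r hr s hs => ?_⟩
    exact (convex_Icc (0 : ℝ) 1).norm_image_sub_le_of_norm_hasDerivWithin_le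
      (fun q _ => (hasDerivAt_walkWeight hj t a y l q).hasDerivWithinAt) hL hr hs

/-- The Euler scheme for the differential equation of `walkWeight` is consistent, with a local
error of second order. -/
theorem exists_euler_error_walkWeight (hj : IsAdmissibleIntensity G j) (t : ℝ) (a y : V)
    (l : List V) : ∃ K : ℝ, 0 ≤ K ∧ ∀ r s, 0 ≤ r → r ≤ s → s ≤ 1 →
      |walkWeight G j t a (y :: l) s -
        (walkWeight G j t a (y :: l) r * (1 - ∫ q in r..s, exitRate G j y q) +
          walkWeight G j t a l r * ∫ q in r..s, arrivalRate G j l y q)| ≤ K * (s - r) ^ 2 := by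
  obtain ⟨C, hC⟩ := hj.bounded
  have hC0 : 0 ≤ C := (exitRate_nonneg hj y 0).trans (exitRate_le hC y 0)
  obtain ⟨L, hL0, hL⟩ := exists_lipschitz_walkWeight hj t a (y :: l)
  obtain ⟨M, hM0, hM⟩ := exists_lipschitz_walkWeight hj t a l
  refine ⟨C * (L + M), by positivity, fun r s hr hrs hs => ?_⟩
  set g := walkWeight G j t a (y :: l) with hg
  set f := walkWeight G j t a l with hf
  set κ := exitRate G j y with hκ
  set k := arrivalRate G j l y with hk
  have hfc : Continuous f := continuous_walkWeight hj t a l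
  have hgc : Continuous g := continuous_walkWeight hj t a (y :: l)
  have hκc : Continuous κ := continuous_exitRate hj y
  have hkc : Continuous k := continuous_arrivalRate hj l y
  have h1 : g s - g r = ∫ q in r..s, (f q * k q - κ q * g q) :=
    (intervalIntegral.integral_eq_sub_of_hasDerivAt
      (fun q _ => hasDerivAt_walkWeight hj t a y l q)
      (((hfc.mul hkc).sub (hκc.mul hgc)).intervalIntegrable _ _)).symm
  have h2 : g s - (g r * (1 - ∫ q in r..s, κ q) + f r * ∫ q in r..s, k q) =
      ∫ q in r..s, ((f q - f r) * k q - κ q * (g q - g r)) := by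
    have h3 : ∀ q, (f q - f r) * k q - κ q * (g q - g r) =
        (f q * k q - κ q * g q) - (f r * k q - g r * κ q) := fun q => by ring
    simp only [h3]
    have h5 : Continuous fun q => f q * k q - κ q * g q := (hfc.mul hkc).sub (hκc.mul hgc)
    have h6 : Continuous fun q => f r * k q := continuous_const.mul hkc
    have h7 : Continuous fun q => g r * κ q := continuous_const.mul hκc
    have h8 : Continuous fun q => f r * k q - g r * κ q := h6.sub h7
    rw [intervalIntegral.integral_sub (h5.intervalIntegrable _ _) (h8.intervalIntegrable _ _),
      intervalIntegral.integral_sub (h6.intervalIntegrable _ _) (h7.intervalIntegrable _ _),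
      intervalIntegral.integral_const_mul, intervalIntegral.integral_const_mul, ← h1]
    ring
  rw [h2, ← Real.norm_eq_abs]
  have h4 : ‖∫ q in r..s, ((f q - f r) * k q - κ q * (g q - g r))‖ ≤
      (C * (L + M) * (s - r)) * |s - r| := by
    refine intervalIntegral.norm_integral_le_of_norm_le_const fun q hq => ?_
    rw [uIoc_of_le hrs] at hq
    have hq01 : q ∈ Icc (0 : ℝ) 1 := ⟨hr.trans hq.1.le, hq.2.trans hs⟩
    have hr01 : r ∈ Icc (0 : ℝ) 1 := ⟨hr, hrs.trans hs⟩
    have hqr : |q - r| ≤ s - r := by rw [abs_of_nonneg (by linarith [hq.1])]; linarith [hq.2]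
    have h5 : |f q - f r| ≤ M * (s - r) :=
      (hM r hr01 q hq01).trans (by gcongr)
    have h6 : |g q - g r| ≤ L * (s - r) :=
      (hL r hr01 q hq01).trans (by gcongr)
    have h7 : |k q| ≤ C := by
      rw [abs_of_nonneg (arrivalRate_nonneg hj l y q)]; exact arrivalRate_le hj hC l y q
    have h8 : |κ q| ≤ C := by
      rw [abs_of_nonneg (exitRate_nonneg hj y q)]; exact exitRate_le hC y q
    rw [Real.norm_eq_abs]
    refine (abs_sub _ _).trans ?_
    rw [abs_mul, abs_mul]
    calc |f q - f r| * |k q| + |κ q| * |g q - g r|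
        ≤ (M * (s - r)) * C + C * (L * (s - r)) := by gcongr
      _ = C * (L + M) * (s - r) := by ring
  rw [abs_of_nonneg (sub_nonneg.2 hrs)] at h4
  linarith

end Weight

section Skeleton

variable {V : Type*} {G : SimpleGraph V} [G.LocallyFinite] {j : ℝ → V → V → ℝ}
  {x : V} {Q : Measure (PathSpace G)}

/-- One step of the discretely observed path, compared with one step of the Euler scheme. -/
theorem SolvesMartingaleProblem.abs_measureReal_trail_succ_le (hj : IsAdmissibleIntensity G j)
    {C : ℝ} (hC : ∀ t ∈ Icc (0 : ℝ) 1, ∀ z, totalRate G j t z ≤ C)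
    (hQ : SolvesMartingaleProblem G j x Q) {t δ : ℝ} (ht : 0 ≤ t) (hδ : 0 ≤ δ)
    {B : Set (PathSpace G)} (hB : MeasurableSet[past G t] B) (i : ℕ)
    (hi : t + (i + 1 : ℕ) * δ ≤ 1) (y : V) (l : List V) :
    |Q.real (B ∩ {w | trail t δ w (i + 1) = y :: l}) -
      (Q.real (B ∩ {w | trail t δ w i = y :: l}) *
          (1 - ∫ r in (t + i * δ)..(t + (i + 1 : ℕ) * δ), exitRate G j y r) +
        Q.real (B ∩ {w | trail t δ w i = l}) *
          ∫ r in (t + i * δ)..(t + (i + 1 : ℕ) * δ), arrivalRate G j l y r)| ≤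
      4 * C ^ 2 * δ ^ 2 := by
  classical
  have := hQ.isProb
  have hiδ : 0 ≤ (i : ℝ) * δ := mul_nonneg i.cast_nonneg hδ
  set s := t + (i + 1 : ℕ) * δ with hs
  set r := t + i * δ with hr
  have hsr : s - r = δ := by rw [hs, hr]; push_cast; ring
  have hr0 : 0 ≤ r := by positivity
  have hrs : r ≤ s := by linarith
  have hBr : MeasurableSet[past G r] B := past_mono (by linarith) _ hB
  have hA : ∀ l', MeasurableSet[past G r] (B ∩ {w | trail t δ w i = l'}) := fun l' =>
    hBr.inter (measurableSet_past_trail hδ i l')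
  have hhead : ∀ z l', ∀ w ∈ B ∩ {w | trail t δ w i = z :: l'}, pos r w = z := by
    rintro z l' w ⟨-, hw⟩
    have := head?_trail t δ w i
    rw [show trail t δ w i = z :: l' from hw] at this
    simpa using this.symm
  set A₂ := B ∩ {w | trail t δ w i = l} ∩ {_w | l.head? ≠ some y} with hA₂
  have hunion : B ∩ {w | trail t δ w (i + 1) = y :: l} =
      (B ∩ {w | trail t δ w i = y :: l} ∩ {w | pos s w = y}) ∪ (A₂ ∩ {w | pos s w = y}) := by
    ext w
    have := trail_succ_eq_cons_iff t δ w i y l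
    simp only [mem_inter_iff, mem_union, mem_ofPred_eq, hA₂]
    rw [this]
    tauto
  have hdisj : Disjoint (B ∩ {w | trail t δ w i = y :: l} ∩ {w | pos s w = y})
      (A₂ ∩ {w | pos s w = y}) := by
    rw [Set.disjoint_left]
    rintro w ⟨⟨-, h1⟩, -⟩ ⟨⟨⟨-, h2⟩, -⟩, -⟩
    have := congrArg List.length ((show trail t δ w i = y :: l from h1).symm.trans h2)
    simp at this
  have hA₂m : MeasurableSet A₂ := (past_le r _ (hA l)).inter (MeasurableSet.const _)
  rw [hunion, measureReal_union hdisj (hA₂m.inter (measurableSet_pos_eq s y))]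
  have h1 := hQ.abs_measureReal_sub_transition_le hj hC hr0 hrs hi (hA (y :: l)) (hhead y l) y
  have h2 : |Q.real (A₂ ∩ {w | pos s w = y}) - Q.real (B ∩ {w | trail t δ w i = l}) *
      ∫ q in r..s, arrivalRate G j l y q| ≤ 2 * C ^ 2 * δ ^ 2 := by
    have hnn : 0 ≤ 2 * C ^ 2 * δ ^ 2 := by positivity
    cases l with
    | nil =>
      have : A₂ ∩ {w | pos s w = y} = ∅ := by
        ext w
        simp only [hA₂, mem_inter_iff, mem_ofPred_eq, mem_empty_iff_false, iff_false]
        exact fun h => trail_ne_nil t δ w i h.1.1.2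
      rw [this]; simpa [arrivalRate] using hnn
    | cons z l =>
      by_cases hzy : z = y
      · subst hzy
        have : A₂ ∩ {w | pos s w = z} = ∅ := by
          ext w; simp [hA₂]
        rw [this]; simpa [arrivalRate, rate_self] using hnn
      · have h3 := hQ.abs_measureReal_sub_transition_le hj hC hr0 hrs hi (hA (z :: l))
          (hhead z l) y
        have h4 : A₂ = B ∩ {w | trail t δ w i = z :: l} := by
          rw [hA₂]; exact inter_eq_left.2 fun w _ => by simpa using hzy
        rw [if_neg hzy, zero_add, hsr] at h3
        rw [h4]
        convert h3 using 5
        rename_i q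
        simp [arrivalRate, netRate, hzy]
  have h5 : (1 : ℝ) + ∫ q in r..s, netRate G j y y q = 1 - ∫ q in r..s, exitRate G j y q := by
    have : ∀ q, netRate G j y y q = - exitRate G j y q := fun q => by simp [netRate, rate_self]
    simp only [this, intervalIntegral.integral_neg, sub_eq_add_neg]
  rw [if_pos rfl, h5, hsr] at h1
  rw [abs_le] at h1 h2 ⊢
  constructor <;> linarith [h1.1, h1.2, h2.1, h2.2]

theorem SolvesMartingaleProblem.exists_abs_measureReal_trail_sub_le
    (hj : IsAdmissibleIntensity G j)
    {C : ℝ} (hC : ∀ t ∈ Icc (0 : ℝ) 1, ∀ z, totalRate G j t z ≤ C)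
    (hQ : SolvesMartingaleProblem G j x Q) {t : ℝ} (ht : 0 ≤ t)
    {B : Set (PathSpace G)} (hB : MeasurableSet[past G t] B) {a : V}
    (hBa : ∀ w ∈ B, pos t w = a) (l : List V) :
    ∃ K : ℝ, 0 ≤ K ∧ ∀ δ : ℝ, 0 ≤ δ → C * δ ≤ 1 → ∀ i : ℕ, t + i * δ ≤ 1 →
      |Q.real (B ∩ {w | trail t δ w i = l}) - Q.real B * walkWeight G j t a l (t + i * δ)| ≤
        K * δ := by
  classical
  have := hQ.isProb
  have hC0 : 0 ≤ C := (exitRate_nonneg hj x 0).trans (exitRate_le hC x 0)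
  induction l with
  | nil =>
    refine ⟨0, le_rfl, fun δ hδ _ i _ => ?_⟩
    have : B ∩ {w | trail t δ w i = []} = ∅ := by
      ext w; simpa using fun _ => trail_ne_nil t δ w i
    rw [this]; simp [walkWeight]
  | cons y l ih =>
    obtain ⟨K₁, hK₁, ih⟩ := ih
    obtain ⟨K₂, hK₂, hE⟩ := exists_euler_error_walkWeight hj t a y l
    set K := K₁ * C + K₂ + 4 * C ^ 2 with hK
    have hK0 : 0 ≤ K := by positivity
    refine ⟨K, hK0, fun δ hδ hCδ i hi => ?_⟩
    -- Local errors of size `K δ ^ 2` accumulate over `i ≤ 1 / δ` steps.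
    suffices H : |Q.real (B ∩ {w | trail t δ w i = y :: l}) -
        Q.real B * walkWeight G j t a (y :: l) (t + i * δ)| ≤ i * (K * δ ^ 2) by
      refine H.trans ?_
      have : (i : ℝ) * δ ≤ 1 := by linarith
      calc (i : ℝ) * (K * δ ^ 2) = (i * δ) * (K * δ) := by ring
        _ ≤ 1 * (K * δ) := by gcongr
        _ = K * δ := one_mul _
    induction i with
    | zero =>
      have hB0 : B ∩ {w | trail t δ w 0 = y :: l} = if y :: l = [a] then B else ∅ := by
        ext w
        split_ifs with h
        · simp only [trail, h, mem_inter_iff, mem_ofPred_eq]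
          exact ⟨fun h => h.1, fun h => ⟨h, by rw [hBa w h]⟩⟩
        · simp only [trail, mem_inter_iff, mem_ofPred_eq, mem_empty_iff_false, iff_false]
          rintro ⟨h1, h2⟩
          exact h (by rw [← h2, hBa w h1])
      rw [hB0, Nat.cast_zero, zero_mul, add_zero, walkWeight_self]
      split_ifs <;> simp
    | succ i ih' =>
      have hiδ : 0 ≤ (i : ℝ) * δ := mul_nonneg i.cast_nonneg hδ
      have hsr : t + (i + 1 : ℕ) * δ - (t + i * δ) = δ := by push_cast; ring
      have h1 := hQ.abs_measureReal_trail_succ_le hj hC ht hδ hB i hi y l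
      have h2 := hE (t + i * δ) (t + (i + 1 : ℕ) * δ) (by linarith) (by linarith) hi
      have h3 := ih δ hδ hCδ i (by linarith)
      have h4 := ih' (by linarith)
      rw [hsr] at h2
      set s := t + (i + 1 : ℕ) * δ with hs
      set r := t + i * δ with hr
      set q := Q.real B with hq
      set c := ∫ p in r..s, exitRate G j y p with hc
      set m := ∫ p in r..s, arrivalRate G j l y p with hm
      set W := walkWeight G j t a (y :: l) with hW
      set F := walkWeight G j t a l with hF
      set a₀ := Q.real (B ∩ {w | trail t δ w i = y :: l}) with ha₀
      set b₀ := Q.real (B ∩ {w | trail t δ w i = l}) with hb₀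
      set a₁ := Q.real (B ∩ {w | trail t δ w (i + 1) = y :: l}) with ha₁
      have hrs : r ≤ s := by linarith
      have hq0 : 0 ≤ q := measureReal_nonneg
      have hq1 : q ≤ 1 := measureReal_le_one
      have hc0 : 0 ≤ c := intervalIntegral.integral_nonneg hrs fun p _ => exitRate_nonneg hj y p
      have hc1 : c ≤ C * δ := by
        have : ‖c‖ ≤ C * |s - r| :=
          intervalIntegral.norm_integral_le_of_norm_le_const fun p _ => by
            rw [Real.norm_eq_abs, abs_of_nonneg (exitRate_nonneg hj y p)]
            exact exitRate_le hC y p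
        rw [hsr, abs_of_nonneg hδ] at this
        exact (le_abs_self c).trans this
      have hm1 : |m| ≤ C * δ := by
        have : ‖m‖ ≤ C * |s - r| :=
          intervalIntegral.norm_integral_le_of_norm_le_const fun p _ => by
            rw [Real.norm_eq_abs, abs_of_nonneg (arrivalRate_nonneg hj l y p)]
            exact arrivalRate_le hj hC l y p
        rwa [hsr, abs_of_nonneg hδ] at this
      have hdecomp : a₁ - q * W s = (a₁ - (a₀ * (1 - c) + b₀ * m)) -
          q * (W s - (W r * (1 - c) + F r * m)) + (1 - c) * (a₀ - q * W r) +
          m * (b₀ - q * F r) := by ring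
      have h5 : |q * (W s - (W r * (1 - c) + F r * m))| ≤ K₂ * δ ^ 2 := by
        rw [abs_mul, abs_of_nonneg hq0]
        exact (mul_le_of_le_one_left (abs_nonneg _) hq1).trans h2
      have h6 : |(1 - c) * (a₀ - q * W r)| ≤ i * (K * δ ^ 2) := by
        rw [abs_mul]
        refine (mul_le_of_le_one_left (abs_nonneg _) ?_).trans h4
        rw [abs_le]; constructor <;> linarith
      have h7 : |m * (b₀ - q * F r)| ≤ (C * δ) * (K₁ * δ) := by
        rw [abs_mul]; gcongr
      rw [hdecomp]
      calc _ ≤ |a₁ - (a₀ * (1 - c) + b₀ * m)| + |q * (W s - (W r * (1 - c) + F r * m))| +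
            |(1 - c) * (a₀ - q * W r)| + |m * (b₀ - q * F r)| :=
          (abs_add_le _ _).trans (add_le_add_left ((abs_add_le _ _).trans
            (add_le_add_left (abs_sub _ _) _)) _)
        _ ≤ 4 * C ^ 2 * δ ^ 2 + K₂ * δ ^ 2 + i * (K * δ ^ 2) + (C * δ) * (K₁ * δ) := by
          gcongr
        _ = ((i + 1 : ℕ) : ℝ) * (K * δ ^ 2) := by push_cast; rw [hK]; ring

/-- Given the past and the present state, the sequence of states visited until a later time has
the explicit law `walkWeight`. This contains the Markov property, and shows that all solutions of
the martingale problem share the same transition mechanism. -/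
theorem SolvesMartingaleProblem.measureReal_skeleton (hj : IsAdmissibleIntensity G j)
    (hQ : SolvesMartingaleProblem G j x Q) {t s : ℝ} (ht : 0 ≤ t) (hts : t ≤ s) (hs : s ≤ 1)
    {B : Set (PathSpace G)} (hB : MeasurableSet[past G t] B) {a : V}
    (hBa : ∀ w ∈ B, pos t w = a) (l : List V) :
    Q.real (B ∩ {w | skeleton t s w = l}) = Q.real B * walkWeight G j t a l s := by
  have := hQ.isProb
  obtain ⟨C, hC⟩ := hj.bounded
  obtain ⟨K, hK, h⟩ := hQ.exists_abs_measureReal_trail_sub_le hj hC ht hB hBa l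
  have hlim := tendsto_measureReal_trail (Q := Q) ht hts hs (past_le t _ hB) l
  have hδ : Tendsto (fun m : ℕ => (s - t) / m) atTop (𝓝 0) :=
    tendsto_const_div_atTop_nhds_zero_nat (s - t)
  have hCδ : Tendsto (fun m : ℕ => C * ((s - t) / m)) atTop (𝓝 0) := by
    simpa using hδ.const_mul C
  have hKδ : Tendsto (fun m : ℕ => K * ((s - t) / m)) atTop (𝓝 0) := by
    simpa using hδ.const_mul K
  refine tendsto_nhds_unique hlim ?_
  rw [tendsto_iff_norm_sub_tendsto_zero]
  refine squeeze_zero' (Eventually.of_forall fun _ => norm_nonneg _) ?_ hKδ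
  filter_upwards [eventually_gt_atTop 0, hCδ.eventually_le_const one_pos] with m hm hm1
  have hm' : (m : ℝ) ≠ 0 := by positivity
  have := h _ (div_nonneg (sub_nonneg.2 hts) m.cast_nonneg) hm1 m ((add_mul_div_le hts m).trans hs)
  rwa [mul_div_cancel₀ _ hm', add_sub_cancel] at this

end Skeleton

end RecipWalk

/-! ### Transition probabilities -/

namespace RecipWalk

section Transition

variable {V : Type*} (G : SimpleGraph V) [G.LocallyFinite] (j : ℝ → V → V → ℝ)

open Classical in
/-- The probability of being in `b` at time `s` when starting from `a` at time `t`, as the sum over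
all sequences of states that end in `b`. -/
noncomputable def transitionProb (t s : ℝ) (a b : V) : ENNReal :=
  ∑' l : List V, if l.head? = some b then ENNReal.ofReal (walkWeight G j t a l s) else 0

variable {G j}

theorem walkWeight_nonneg (hj : IsAdmissibleIntensity G j) {t s : ℝ} (hts : t ≤ s) (a : V)
    (l : List V) : 0 ≤ walkWeight G j t a l s := by
  induction l generalizing s with
  | nil => exact le_rfl
  | cons y l ih =>
    refine mul_nonneg (Real.exp_pos _).le (add_nonneg (by split_ifs <;> simp) ?_)
    exact intervalIntegral.integral_nonneg hts fun r hr =>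
      mul_nonneg (mul_nonneg (ih hr.1) (arrivalRate_nonneg hj l y r)) (Real.exp_pos _).le

theorem walkWeight_singleton (t s : ℝ) (a : V) :
    walkWeight G j t a [a] s = Real.exp (-∫ r in t..s, exitRate G j a r) := by
  simp [walkWeight]

theorem walkWeight_cons_cons (t s : ℝ) (a y z : V) (l : List V) :
    walkWeight G j t a (y :: z :: l) s = Real.exp (-∫ r in t..s, exitRate G j y r) *
      ∫ r in t..s, walkWeight G j t a (z :: l) r * rate G j z y r *
        Real.exp (∫ q in t..r, exitRate G j y q) := by
  simp [walkWeight, arrivalRate]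

theorem exists_walkWeight_pos (hj : IsAdmissibleIntensity G j) {a b : V} (c : G.Walk b a) :
    ∃ l : List V, l.head? = some b ∧ ∀ t s : ℝ, t < s → 0 < walkWeight G j t a l s := by
  induction c with
  | nil =>
    refine ⟨[_], rfl, fun t s _ => ?_⟩
    rw [walkWeight_singleton]; exact Real.exp_pos _
  | @cons y z a h p ih =>
    obtain ⟨l, hl, hpos⟩ := ih
    cases l with
    | nil => simp at hl
    | cons z' l =>
      obtain rfl : z' = z := by simpa using hl
      refine ⟨y :: z' :: l, rfl, fun t s hts => ?_⟩
      rw [walkWeight_cons_cons]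
      refine mul_pos (Real.exp_pos _) (intervalIntegral.intervalIntegral_pos_of_pos_on ?_ ?_ hts)
      · exact (((continuous_walkWeight hj t a _).mul (continuous_rate hj z' y)).mul
          (Real.continuous_exp.comp (continuous_integral_exitRate hj y t))).intervalIntegrable _ _
      · exact fun r hr => mul_pos (mul_pos (hpos t r hr.1) (rate_pos hj h.symm r))
          (Real.exp_pos _)

theorem transitionProb_ne_zero (hconn : G.Preconnected) (hj : IsAdmissibleIntensity G j)
    {t s : ℝ} (hts : t < s) (a b : V) : transitionProb G j t s a b ≠ 0 := by
  obtain ⟨c⟩ := hconn b a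
  obtain ⟨l, hl, hpos⟩ := exists_walkWeight_pos hj c
  intro h
  have := ENNReal.tsum_eq_zero.1 h l
  rw [if_pos hl, ENNReal.ofReal_eq_zero] at this
  exact absurd this (not_le.2 (hpos t s hts))

variable {x : V} {Q : Measure (PathSpace G)}

theorem SolvesMartingaleProblem.measure_skeleton (hj : IsAdmissibleIntensity G j)
    (hQ : SolvesMartingaleProblem G j x Q) {t s : ℝ} (ht : 0 ≤ t) (hts : t ≤ s) (hs : s ≤ 1)
    {B : Set (PathSpace G)} (hB : MeasurableSet[past G t] B) {a : V}
    (hBa : ∀ w ∈ B, pos t w = a) (l : List V) :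
    Q (B ∩ {w | skeleton t s w = l}) = Q B * ENNReal.ofReal (walkWeight G j t a l s) := by
  have := hQ.isProb
  rw [← ofReal_measureReal, hQ.measureReal_skeleton hj ht hts hs hB hBa,
    ENNReal.ofReal_mul measureReal_nonneg, ofReal_measureReal]

theorem SolvesMartingaleProblem.measure_pos_eq [Countable V] (hj : IsAdmissibleIntensity G j)
    (hQ : SolvesMartingaleProblem G j x Q) {t s : ℝ} (ht : 0 ≤ t) (hts : t ≤ s) (hs : s ≤ 1)
    {B : Set (PathSpace G)} (hB : MeasurableSet[past G t] B) {a : V}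
    (hBa : ∀ w ∈ B, pos t w = a) (b : V) :
    Q (B ∩ {w | pos s w = b}) = Q B * transitionProb G j t s a b := by
  have hU : B ∩ {w | pos s w = b} =
      ⋃ l : List V, (B ∩ {w | skeleton t s w = l}) ∩ {_w | l.head? = some b} := by
    ext w
    have := head?_skeleton ht hts hs w
    simp only [mem_inter_iff, mem_ofPred_eq, mem_iUnion]
    constructor
    · rintro ⟨h1, h2⟩
      exact ⟨_, ⟨h1, rfl⟩, by rw [this, h2]⟩
    · rintro ⟨l, ⟨h1, rfl⟩, h2⟩
      exact ⟨h1, by rw [this] at h2; simpa using h2⟩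
  have hm : ∀ l : List V, MeasurableSet (B ∩ {w : PathSpace G | skeleton t s w = l}) := fun l =>
    (past_le t _ hB).inter (past_le s _ (measurableSet_past_skeleton ht hts hs l))
  rw [hU, measure_iUnion, transitionProb, ← ENNReal.tsum_mul_left]
  · refine tsum_congr fun l => ?_
    by_cases h : l.head? = some b
    · simp only [h, if_true]
      rw [show ({_w | True} : Set (PathSpace G)) = univ from rfl, inter_univ,
        hQ.measure_skeleton hj ht hts hs hB hBa]
    · simp [h]
  · intro l l' hll
    refine Set.disjoint_left.2 ?_
    rintro w ⟨⟨-, h1⟩, -⟩ ⟨⟨-, h2⟩, -⟩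
    exact hll ((show skeleton t s w = l from h1).symm.trans h2)
  · exact fun l => (hm l).inter (MeasurableSet.const _)

theorem SolvesMartingaleProblem.measure_initial (hQ : SolvesMartingaleProblem G j x Q) :
    Q {w | pos 0 w = x} = 1 := by
  have := hQ.isProb
  rw [← prob_compl_eq_zero_iff (measurableSet_pos_eq 0 x)]
  have h := hQ.initial
  rw [ae_iff] at h
  have he : ∀ w : PathSpace G, coord 0 w = pos 0 w := fun w => by
    rw [pos, projIcc_left]; rfl
  simp only [he] at h
  exact h

theorem SolvesMartingaleProblem.measure_pos_ne_zero [Countable V] (hconn : G.Preconnected)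
    (hj : IsAdmissibleIntensity G j) (hQ : SolvesMartingaleProblem G j x Q) {t : ℝ} (ht : 0 < t)
    (ht1 : t ≤ 1) (a : V) : Q {w | pos t w = a} ≠ 0 := by
  intro h
  have h1 := hQ.measure_pos_eq hj le_rfl ht.le ht1 (measurableSet_past_pos_eq (G := G) le_rfl x)
    (fun w hw => hw) a
  rw [hQ.measure_initial, one_mul] at h1
  exact transitionProb_ne_zero hconn hj ht x a
    (h1.symm.trans (measure_mono_null inter_subset_right h))

/-- No fixed time is a jump time with positive probability. -/
theorem SolvesMartingaleProblem.measure_isJump [Countable V] (hj : IsAdmissibleIntensity G j)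
    (hQ : SolvesMartingaleProblem G j x Q) {s : ℝ} (hs : s ∈ Icc (0 : ℝ) 1) (hs0 : 0 < s) :
    Q {w | IsJump w.1 ⟨s, hs⟩} = 0 := by
  have := hQ.isProb
  obtain ⟨C, hC⟩ := hj.bounded
  set N := {w : PathSpace G | IsJump w.1 ⟨s, hs⟩} with hN
  have key : ∀ r ∈ Ioo 0 s, Q N ≤ ENNReal.ofReal (C * (s - r)) := by
    intro r hr
    have hU : N ⊆ ⋃ a : V, {w | pos r w = a} \ {w | skeleton r s w = [a]} := fun w hw =>
      mem_iUnion.2 ⟨pos r w, rfl, skeleton_ne_singleton_of_isJump hr.2 hs hw _⟩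
    have hV : ∑' a : V, Q {w | pos r w = a} = 1 := by
      rw [← measure_iUnion _ fun a => measurableSet_pos_eq r a]
      · rw [show (⋃ a : V, {w : PathSpace G | pos r w = a}) = univ from
          eq_univ_of_forall fun w => mem_iUnion.2 ⟨_, rfl⟩, measure_univ]
      · intro a b hab
        exact Set.disjoint_left.2 fun w h1 h2 =>
          hab ((show pos r w = a from h1).symm.trans h2)
    have hC0 : 0 ≤ C * (s - r) := mul_nonneg
      ((exitRate_nonneg hj x 0).trans (exitRate_le hC x 0)) (sub_nonneg.2 hr.2.le)
    calc Q N ≤ ∑' a : V, Q ({w | pos r w = a} \ {w | skeleton r s w = [a]}) :=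
          (measure_mono hU).trans (measure_iUnion_le _)
      _ ≤ ∑' a : V, ENNReal.ofReal (C * (s - r)) * Q {w | pos r w = a} := by
          refine ENNReal.tsum_le_tsum fun a => ?_
          have h := hQ.measureReal_diff_skeleton_le hj hC hr.1.le hr.2.le hs.2
            (measurableSet_past_pos_eq (G := G) le_rfl a) (fun w hw => hw)
          rw [← ofReal_measureReal, ← ofReal_measureReal (s := {w | pos r w = a}),
            ← ENNReal.ofReal_mul hC0]
          exact ENNReal.ofReal_le_ofReal h
      _ = ENNReal.ofReal (C * (s - r)) := by rw [ENNReal.tsum_mul_left, hV, mul_one]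
  have hlim : Tendsto (fun r => ENNReal.ofReal (C * (s - r))) (𝓝[<] s) (𝓝 0) := by
    have : Continuous fun r : ℝ => ENNReal.ofReal (C * (s - r)) :=
      ENNReal.continuous_ofReal.comp (by fun_prop)
    have h := (this.tendsto s).mono_left (nhdsWithin_le_nhds (s := Iio s))
    simpa using h
  refine le_antisymm (ge_of_tendsto hlim ?_) bot_le
  filter_upwards [Ioo_mem_nhdsLT hs0] with r hr using key r hr

theorem SolvesMartingaleProblem.transitionProb_bounds [Countable V] (hconn : G.Preconnected)
    (hj : IsAdmissibleIntensity G j) (hQ : SolvesMartingaleProblem G j x Q) {t s : ℝ}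
    (ht : 0 < t) (hts : t ≤ s) (hs : s ≤ 1) (a : V) :
    Real.exp (-∫ r in t..s, exitRate G j a r) ≤ (transitionProb G j t s a a).toReal ∧
      (transitionProb G j t s a a).toReal ≤ 1 := by
  have := hQ.isProb
  have hB := measurableSet_past_pos_eq (G := G) (le_refl t) a
  have h1 := congrArg ENNReal.toReal (hQ.measure_pos_eq hj ht.le hts hs hB (fun w hw => hw) a)
  have h2 := hQ.measureReal_skeleton hj ht.le hts hs hB (fun w hw => hw) [a]
  rw [ENNReal.toReal_mul] at h1
  change Q.real _ = Q.real _ * _ at h1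
  rw [walkWeight_singleton] at h2
  have hpos : 0 < Q.real {w | pos t w = a} := ENNReal.toReal_pos
    (hQ.measure_pos_ne_zero hconn hj ht (hts.trans hs) a) (measure_ne_top _ _)
  constructor
  · refine le_of_mul_le_mul_left ?_ hpos
    rw [← h1, ← h2]
    refine measureReal_mono fun w hw => ⟨hw.1, ?_⟩
    have h3 := head?_skeleton ht.le hts hs w
    rw [show skeleton t s w = [a] from hw.2] at h3
    simpa using h3.symm
  · refine le_of_mul_le_mul_left ?_ hpos
    rw [← h1, mul_one]
    exact measureReal_mono inter_subset_left

end Transition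

/-! ### The reciprocal class -/

section Reciprocal

variable {V : Type*} {G : SimpleGraph V} {j : ℝ → V → V → ℝ}

theorem measurableSet_endpoints (x y : V) :
    MeasurableSet {w : PathSpace G | coord 0 w = x ∧ coord 1 w = y} := by
  have h0 : ∀ w : PathSpace G, coord 0 w = pos 0 w := fun w => by rw [pos, projIcc_left]; rfl
  have h1 : ∀ w : PathSpace G, coord 1 w = pos 1 w := fun w => by rw [pos, projIcc_right]; rfl
  simp only [h0, h1]
  exact (measurableSet_pos_eq 0 x).inter (measurableSet_pos_eq 1 y)

/-- Only the walk started at `x` contributes to events with `X_0 = x`. -/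
theorem measure_sum_endpoints_inter [G.LocallyFinite] {R₀ : PMF V} {Rx : V → Measure (PathSpace G)}
    (hRx : ∀ x, SolvesMartingaleProblem G j x (Rx x)) (x y : V) {A : Set (PathSpace G)}
    (hA : MeasurableSet A) :
    Measure.sum (fun x => R₀ x • Rx x) ({w | coord 0 w = x ∧ coord 1 w = y} ∩ A) =
      R₀ x * Rx x (A ∩ {w | pos 1 w = y}) := by
  have h1 : ∀ w : PathSpace G, coord 1 w = pos 1 w := fun w => by rw [pos, projIcc_right]; rfl
  rw [Measure.sum_apply _ ((measurableSet_endpoints x y).inter hA), tsum_eq_single x]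
  · rw [Measure.smul_apply, smul_eq_mul]
    congr 1
    refine measure_congr ?_
    filter_upwards [(hRx x).initial] with w hw
    refine propext ?_
    change ((coord 0 w = x ∧ coord 1 w = y) ∧ w ∈ A) ↔ (w ∈ A ∧ pos 1 w = y)
    rw [h1]; tauto
  · intro z hz
    rw [Measure.smul_apply, smul_eq_mul, mul_eq_zero]
    right
    have hz0 : Rx z {w | ¬ coord 0 w = z} = 0 := ae_iff.1 (hRx z).initial
    refine measure_mono_null (fun w hw => ?_) hz0
    exact fun h : coord 0 w = z => hz (h.symm.trans hw.1.1)

theorem IsReferenceWalk.isProbabilityMeasure [G.LocallyFinite] {R : Measure (PathSpace G)}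
    (hR : IsReferenceWalk G j R) : IsProbabilityMeasure R := by
  obtain ⟨R₀, Rx, -, hRx, rfl⟩ := hR
  refine ⟨?_⟩
  have := fun x => (hRx x).isProb
  simp [Measure.sum_apply, PMF.tsum_coe]

theorem measure_univ_le_one_of_mem_reciprocalClass [G.LocallyFinite] {P : Measure (PathSpace G)}
    (hP : P ∈ reciprocalClass G j) : P univ ≤ 1 := by
  obtain ⟨R, hR, π, -, rfl⟩ := hP
  have := hR.isProbabilityMeasure
  rw [Measure.sum_apply _ MeasurableSet.univ, ← π.tsum_coe]
  refine ENNReal.tsum_le_tsum fun p => ?_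
  rw [Measure.smul_apply, smul_eq_mul]
  unfold bridge
  exact mul_le_of_le_one_right' prob_le_one

theorem measure_isJump_of_mem_reciprocalClass [Countable V] [G.LocallyFinite]
    (hj : IsAdmissibleIntensity G j)
    {P : Measure (PathSpace G)} (hP : P ∈ reciprocalClass G j) {s : ℝ} (hs : s ∈ Icc (0 : ℝ) 1)
    (hs0 : 0 < s) : P {w | IsJump w.1 ⟨s, hs⟩} = 0 := by
  obtain ⟨R, ⟨R₀, Rx, -, hRx, rfl⟩, π, -, rfl⟩ := hP
  rw [Measure.sum_apply_eq_zero]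
  intro p
  rw [Measure.smul_apply, smul_eq_mul, mul_eq_zero]
  right
  refine cond_absolutelyContinuous ?_
  rw [Measure.sum_apply_eq_zero]
  intro x
  rw [Measure.smul_apply, (hRx x).measure_isJump hj hs hs0, smul_zero]

theorem exists_solution_of_mem_reciprocalClass [G.LocallyFinite] {P : Measure (PathSpace G)}
    (hP : P ∈ reciprocalClass G j) : ∃ x Q, SolvesMartingaleProblem G j x Q := by
  obtain ⟨R, ⟨R₀, Rx, -, hRx, rfl⟩, -⟩ := hP
  obtain ⟨x, -⟩ := R₀.support_nonempty
  exact ⟨x, Rx x, hRx x⟩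

/-- Reciprocal property: on events of the past of `s` that fix the states at times `t` and `s`,
a member of the reciprocal class is proportional to the reference dynamics started from `a` at
time `t`. -/
theorem exists_measureReal_eq_mul [Countable V] [G.LocallyFinite] (hconn : G.Preconnected)
    (hj : IsAdmissibleIntensity G j) {P : Measure (PathSpace G)} (hP : P ∈ reciprocalClass G j)
    {t s : ℝ} (ht : 0 < t) (hts : t < s) (hs : s < 1) (a b : V) :
    ∃ K : ℝ, 0 < K ∧ ∀ (A : Set (PathSpace G)) (g : ℝ), 0 ≤ g → MeasurableSet[past G s] A →
      (∀ w ∈ A, pos s w = b) →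
      (∀ x Q, SolvesMartingaleProblem G j x Q → Q.real A = Q.real {w | pos t w = a} * g) →
      P.real A = K * g := by
  have hPu := measure_univ_le_one_of_mem_reciprocalClass hP
  obtain ⟨R, hR, π, hπ, rfl⟩ := hP
  have hRp := hR.isProbabilityMeasure
  obtain ⟨R₀, Rx, hR₀, hRx, rfl⟩ := hR
  set R := Measure.sum fun x => R₀ x • Rx x with hRdef
  set P := Measure.sum fun p : V × V => π p • bridge R p.1 p.2 with hPdef
  set K : ENNReal := ∑' p : V × V, π p * ((R {w | coord 0 w = p.1 ∧ coord 1 w = p.2})⁻¹ *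
    (R₀ p.1 * (Rx p.1 {w | pos t w = a} * transitionProb G j s 1 b p.2))) with hK
  have hK0 : K ≠ 0 := by
    obtain ⟨p, hp⟩ := π.support_nonempty
    intro h
    have h1 := ENNReal.tsum_eq_zero.1 h p
    simp only [mul_eq_zero, ENNReal.inv_eq_zero] at h1
    rcases h1 with h1 | h1 | h1 | h1 | h1
    · exact hp h1
    · exact measure_ne_top _ _ h1
    · have : p.1 ∈ R₀.support := by rw [hR₀]; trivial
      exact this h1
    · exact (hRx p.1).measure_pos_ne_zero hconn hj ht (hts.trans hs).le a h1
    · exact transitionProb_ne_zero hconn hj hs b p.2 h1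
  have key : ∀ (A : Set (PathSpace G)) (g : ℝ), 0 ≤ g → MeasurableSet[past G s] A →
      (∀ w ∈ A, pos s w = b) →
      (∀ x Q, SolvesMartingaleProblem G j x Q → Q.real A = Q.real {w | pos t w = a} * g) →
      P A = K * ENNReal.ofReal g := by
    intro A g hg hA hAb hAg
    have hAm := past_le s _ hA
    rw [hPdef, Measure.sum_apply _ hAm, hK, ← ENNReal.tsum_mul_right]
    refine tsum_congr fun p => ?_
    have := (hRx p.1).isProb
    have h1 : Rx p.1 A = Rx p.1 {w | pos t w = a} * ENNReal.ofReal g := by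
      rw [← ofReal_measureReal, hAg p.1 _ (hRx p.1), ENNReal.ofReal_mul measureReal_nonneg,
        ofReal_measureReal]
    rw [Measure.smul_apply, smul_eq_mul, bridge, cond_apply (measurableSet_endpoints _ _),
      measure_sum_endpoints_inter hRx _ _ hAm,
      (hRx p.1).measure_pos_eq hj (ht.trans hts).le hs.le le_rfl hA hAb, h1]
    ring
  -- `K` times a positive number is the probability of some event.
  have hKtop : K ≠ ⊤ := by
    obtain ⟨c⟩ := hconn b a
    obtain ⟨l, hl, hpos⟩ := exists_walkWeight_pos hj c
    have hB := measurableSet_past_pos_eq (G := G) (le_refl t) a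
    have h1 := key ({w | pos t w = a} ∩ {w | skeleton t s w = l}) (walkWeight G j t a l s)
      (hpos t s hts).le ((past_mono hts.le _ hB).inter
        (measurableSet_past_skeleton ht.le hts.le hs.le l)) (fun w hw => by
          have h3 := head?_skeleton ht.le hts.le hs.le w
          rw [show skeleton t s w = l from hw.2, hl] at h3
          simpa using h3.symm)
      (fun x Q hQ => hQ.measureReal_skeleton hj ht.le hts.le hs.le hB (fun w hw => hw) l)
    intro htop
    rw [htop, ENNReal.top_mul (by simpa using hpos t s hts)] at h1
    exact absurd (h1 ▸ (measure_mono (subset_univ _)).trans hPu) (by simp)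
  refine ⟨K.toReal, ENNReal.toReal_pos hK0 hKtop, fun A g hg hA hAb hAg => ?_⟩
  rw [measureReal_def, key A g hg hA hAb hAg, ENNReal.toReal_mul, ENNReal.toReal_ofReal hg]

end Reciprocal

end RecipWalk

/-! ### Short-time asymptotics -/

namespace RecipWalk

theorem tendsto_const_add_nhdsGT (t : ℝ) : Tendsto (fun h : ℝ => t + h) (𝓝[>] 0) (𝓝[>] t) := by
  refine tendsto_nhdsWithin_iff.2 ⟨?_, ?_⟩
  · have : Tendsto (fun h : ℝ => t + h) (𝓝 0) (𝓝 (t + 0)) := by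
      exact (continuous_const.add continuous_id).tendsto 0
    rw [add_zero] at this
    exact this.mono_left nhdsWithin_le_nhds
  · filter_upwards [self_mem_nhdsWithin] with h hh
    simpa using hh

/-- Second order expansion of the ratio of the integrals over a half interval and over the whole
interval. -/
theorem isLittleO_integral_ratio {φ : ℝ → ℝ} (hφ : Continuous φ) {t φ' : ℝ}
    (hd : HasDerivAt φ φ' t) (h0 : φ t ≠ 0) :
    (fun h : ℝ => (∫ r in t..t + h / 2, φ r) / (∫ r in t..t + h, φ r) -
      (1 / 2 - h / 8 * (φ' / φ t))) =o[𝓝[>] 0] fun h : ℝ => h := by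
  set Φ : ℝ → ℝ := fun h => ∫ r in t..t + h, φ r with hΦ
  set p := φ t with hp
  -- `D h` is the normalized second order remainder: `Φ h = p h + D h * h ^ 2`.
  set D : ℝ → ℝ := fun h => (Φ h - p * h) / h ^ 2 with hD
  have hΦd : ∀ h, HasDerivAt Φ (φ (t + h)) h := fun h => by
    have h1 := (hφ.integral_hasStrictDerivAt t (t + h)).hasDerivAt
    exact h1.comp_const_add t h
  have hpow : ∀ h : ℝ, HasDerivAt (fun h : ℝ => h ^ 2) (2 * h) h := fun h => by
    simpa using hasDerivAt_pow 2 h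
  have hnum : ∀ h : ℝ, HasDerivAt (fun h => Φ h - p * h) (φ (t + h) - p) h := fun h =>
    ((hΦd h).sub ((hasDerivAt_id h).const_mul p)).congr_deriv (by simp)
  have hDlim : Tendsto D (𝓝[>] 0) (𝓝 (φ' / 2)) := by
    refine HasDerivAt.lhopital_zero_nhdsGT (Eventually.of_forall hnum)
      (Eventually.of_forall hpow) ?_ ?_ ?_ ?_
    · filter_upwards [self_mem_nhdsWithin] with h hh
      exact mul_ne_zero two_ne_zero (ne_of_gt hh)
    · have := (hnum 0).continuousAt.tendsto
      simp only [hΦ, add_zero, intervalIntegral.integral_same, mul_zero, sub_zero] at this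
      exact this.mono_left nhdsWithin_le_nhds
    · have := (hpow 0).continuousAt.tendsto
      simp only [ne_eq, OfNat.ofNat_ne_zero, not_false_eq_true, zero_pow] at this
      exact this.mono_left nhdsWithin_le_nhds
    · have h1 := hd.tendsto_slope_zero_right
      have h2 := h1.div_const 2
      refine h2.congr fun h => ?_
      rw [smul_eq_mul, ← hp]
      field_simp
  have hhalf : Tendsto (fun h : ℝ => h / 2) (𝓝[>] 0) (𝓝[>] 0) := by
    refine tendsto_nhdsWithin_iff.2 ⟨?_, ?_⟩
    · have : Tendsto (fun h : ℝ => h / 2) (𝓝 0) (𝓝 (0 / 2)) :=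
        (continuous_id.div_const 2).tendsto 0
      rw [zero_div] at this
      exact this.mono_left nhdsWithin_le_nhds
    · filter_upwards [self_mem_nhdsWithin] with h hh
      exact half_pos (show (0 : ℝ) < h from hh)
  have hD2 := hDlim.comp hhalf
  have hid : Tendsto (fun h : ℝ => h) (𝓝[>] 0) (𝓝 0) := nhdsWithin_le_nhds
  have hden : Tendsto (fun h => p + D h * h) (𝓝[>] 0) (𝓝 p) := by
    simpa using (tendsto_const_nhds (x := p)).add (hDlim.mul hid)
  have hrepr : ∀ h : ℝ, 0 < h → Φ h = p * h + D h * h ^ 2 := fun h hh => by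
    simp only [hD]; field_simp; ring
  rw [isLittleO_iff_tendsto' (by
    filter_upwards [self_mem_nhdsWithin] with h hh h'
    exact absurd h' (ne_of_gt hh))]
  have hlim : Tendsto (fun h => (D (h / 2) / 4 - D h / 2) / (p + D h * h) + 1 / 8 * (φ' / p))
      (𝓝[>] 0) (𝓝 0) := by
    have h1 := (((hD2.div_const 4).sub (hDlim.div_const 2)).div hden h0).add_const
      (1 / 8 * (φ' / p))
    have h2 : (φ' / 2 / 4 - φ' / 2 / 2) / p + 1 / 8 * (φ' / p) = 0 := by field_simp; ring
    rw [h2] at h1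
    exact h1
  refine hlim.congr' ?_
  filter_upwards [self_mem_nhdsWithin, hden.eventually_ne h0] with h hh hne
  have hh' : (0 : ℝ) < h := hh
  change _ = (Φ (h / 2) / Φ h - (1 / 2 - h / 8 * (φ' / p))) / h
  have e1 : Φ h = h * (p + D h * h) := by rw [hrepr h hh']; ring
  have e2 : Φ (h / 2) = h * (p / 2 + D (h / 2) * h / 4) := by
    rw [hrepr (h / 2) (half_pos hh')]; ring
  rw [e1, e2, mul_div_mul_left _ _ hh'.ne']
  set q := p + D h * h with hq
  have e3 : p = q - D h * h := by rw [hq]; ring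
  have e4 : (p / 2 + D (h / 2) * h / 4) / q = 1 / 2 + h * ((D (h / 2) / 4 - D h / 2) / q) := by
    rw [e3]; field_simp; ring
  rw [e4]
  field_simp
  ring

section Weight

variable {V : Type*} {G : SimpleGraph V} [G.LocallyFinite] {j : ℝ → V → V → ℝ}

theorem tendsto_walkWeight_history_div (hj : IsAdmissibleIntensity G j) (t : ℝ) (f : ℕ → V)
    (n : ℕ) :
    Tendsto (fun s => walkWeight G j t (f 0) (history f n) s / (s - t) ^ n) (𝓝[>] t)
      (𝓝 ((∏ i ∈ Finset.range n, rate G j (f i) (f (i + 1)) t) / (n.factorial : ℝ))) := by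
  induction n with
  | zero =>
    have h := (continuous_walkWeight hj t (f 0) [f 0]).tendsto t
    rw [walkWeight_self, if_pos rfl] at h
    simpa [history] using h.mono_left nhdsWithin_le_nhds
  | succ n ih =>
    set W := walkWeight G j t (f 0) (history f n) with hW
    set y := f (n + 1) with hy
    set E : ℝ → ℝ := fun s => ∫ r in t..s, exitRate G j y r with hE
    have hrate : ∀ r, arrivalRate G j (history f n) y r = rate G j (f n) y r := fun r => by
      cases n <;> rfl
    have hrate' : ∀ r, arrivalRate G j (history f n) (f (n + 1)) r =
        rate G j (f n) (f (n + 1)) r := hrate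
    have hne : history f n ≠ [] := fun h => by
      have := length_history f n; simp [h] at this
    have hWc : Continuous W := continuous_walkWeight hj t _ _
    have hEc : Continuous E := continuous_integral_exitRate hj y t
    have hkc : Continuous (rate G j (f n) y) := continuous_rate hj _ _
    have hw : ∀ s, walkWeight G j t (f 0) (history f (n + 1)) s =
        Real.exp (-E s) * ∫ r in t..s, W r * rate G j (f n) y r * Real.exp (E r) := fun s => by
      rw [history, walkWeight]
      simp [hne, hE, hW, hrate']
      rfl
    have hI : ∀ s, HasDerivAt (fun s => ∫ r in t..s, W r * rate G j (f n) y r * Real.exp (E r))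
        (W s * rate G j (f n) y s * Real.exp (E s)) s := fun s =>
      (((hWc.mul hkc).mul (Real.continuous_exp.comp hEc)).integral_hasStrictDerivAt t s).hasDerivAt
    have hpow : ∀ s, HasDerivAt (fun s : ℝ => (s - t) ^ (n + 1)) (((n : ℝ) + 1) * (s - t) ^ n) s :=
      fun s => (((hasDerivAt_id s).sub_const t).pow (n + 1)).congr_deriv (by simp)
    have hE0 : E t = 0 := by simp [hE]
    have hlim : Tendsto (fun s => (∫ r in t..s, W r * rate G j (f n) y r * Real.exp (E r)) /
        (s - t) ^ (n + 1)) (𝓝[>] t) (𝓝 ((∏ i ∈ Finset.range (n + 1),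
          rate G j (f i) (f (i + 1)) t) / ((n + 1).factorial : ℝ))) := by
      refine HasDerivAt.lhopital_zero_nhdsGT (Eventually.of_forall hI)
        (Eventually.of_forall hpow) ?_ ?_ ?_ ?_
      · filter_upwards [self_mem_nhdsWithin] with s hs
        have : 0 < s - t := sub_pos.2 hs
        positivity
      · have := (hI t).continuousAt.tendsto
        simp only [intervalIntegral.integral_same] at this
        exact this.mono_left nhdsWithin_le_nhds
      · have := (hpow t).continuousAt.tendsto
        simp only [sub_self, ne_eq, Nat.succ_ne_zero, not_false_eq_true, zero_pow] at this
        exact this.mono_left nhdsWithin_le_nhds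
      · have h1 : Tendsto (fun s => rate G j (f n) y s * Real.exp (E s)) (𝓝[>] t)
            (𝓝 (rate G j (f n) y t)) := by
          have : Tendsto (fun s => rate G j (f n) y s * Real.exp (E s)) (𝓝 t)
              (𝓝 (rate G j (f n) y t * Real.exp (E t))) :=
            (hkc.mul (Real.continuous_exp.comp hEc)).tendsto t
          rw [hE0, Real.exp_zero, mul_one] at this
          exact this.mono_left nhdsWithin_le_nhds
        have h2 := (ih.mul h1).div_const ((n : ℝ) + 1)
        have h3 : (∏ i ∈ Finset.range n, rate G j (f i) (f (i + 1)) t) / (n.factorial : ℝ) *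
            rate G j (f n) y t / ((n : ℝ) + 1) = (∏ i ∈ Finset.range (n + 1),
              rate G j (f i) (f (i + 1)) t) / ((n + 1).factorial : ℝ) := by
          rw [Finset.prod_range_succ, Nat.factorial_succ, ← hy]
          push_cast
          have : (n.factorial : ℝ) ≠ 0 := by positivity
          field_simp
        rw [h3] at h2
        refine h2.congr' ?_
        filter_upwards [self_mem_nhdsWithin] with s hs
        have : 0 < s - t := sub_pos.2 hs
        field_simp
    have hexp : Tendsto (fun s => Real.exp (-E s)) (𝓝[>] t) (𝓝 1) := by
      have : Tendsto (fun s => Real.exp (-E s)) (𝓝 t) (𝓝 (Real.exp (-E t))) :=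
        (Real.continuous_exp.comp hEc.neg).tendsto t
      rw [hE0, neg_zero, Real.exp_zero] at this
      exact this.mono_left nhdsWithin_le_nhds
    have h4 := hexp.mul hlim
    rw [one_mul] at h4
    refine h4.congr fun s => ?_
    rw [hw, mul_div_assoc]

/-- The density at time `r` of a jump `z → z'`, up to a factor which does not depend on `r`. -/
noncomputable def jumpDensity (G : SimpleGraph V) [G.LocallyFinite] (j : ℝ → V → V → ℝ) (t : ℝ)
    (z z' : V) (r : ℝ) : ℝ :=
  Real.exp (-∫ q in t..r, exitRate G j z q) * rate G j z z' r *
    Real.exp (∫ q in t..r, exitRate G j z' q)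

theorem walkWeight_pair (t s : ℝ) (z z' : V) :
    walkWeight G j t z [z', z] s = Real.exp (-∫ r in t..s, exitRate G j z' r) *
      ∫ r in t..s, jumpDensity G j t z z' r := by
  rw [walkWeight_cons_cons]
  simp only [walkWeight_singleton]
  rfl

theorem walkWeight_pair_mul_singleton (hj : IsAdmissibleIntensity G j) (t u s : ℝ) (z z' : V) :
    walkWeight G j t z [z', z] u * walkWeight G j u z' [z'] s =
      Real.exp (-∫ r in t..s, exitRate G j z' r) * ∫ r in t..u, jumpDensity G j t z z' r := by
  have hc := continuous_exitRate hj z'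
  rw [walkWeight_pair, walkWeight_singleton, ← intervalIntegral.integral_add_adjacent_intervals
    (hc.intervalIntegrable t u) (hc.intervalIntegrable u s), neg_add, Real.exp_add]
  ring

theorem continuous_jumpDensity (hj : IsAdmissibleIntensity G j) (t : ℝ) (z z' : V) :
    Continuous (jumpDensity G j t z z') :=
  ((Real.continuous_exp.comp (continuous_integral_exitRate hj z t).neg).mul
    (continuous_rate hj z z')).mul (Real.continuous_exp.comp (continuous_integral_exitRate hj z' t))

theorem jumpDensity_self {t : ℝ} (ht : t ∈ Icc (0 : ℝ) 1) {z z' : V} (h : G.Adj z z') :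
    jumpDensity G j t z z' t = j t z z' := by
  simp [jumpDensity, rate_of_mem h ht]

/-- The logarithmic derivative of the density of the jump time is the arc characteristic. -/
theorem hasDerivAt_jumpDensity (hj : IsAdmissibleIntensity G j) {t : ℝ} (ht : t ∈ Ioo (0 : ℝ) 1)
    {z z' : V} (h : G.Adj z z') :
    HasDerivAt (jumpDensity G j t z z') (j t z z' * arcCharacteristic G j t z z') t := by
  have ht' := Ioo_subset_Icc_self ht
  have hjp := hj.pos t ht' z z' h
  have hjd : DifferentiableAt ℝ (fun s => j s z z') t :=
    ((hj.contDiff z z' h).contDiffAt (Icc_mem_nhds ht.1 ht.2)).differentiableAt one_ne_zero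
  have hrate : HasDerivAt (rate G j z z') (deriv (fun s => j s z z') t) t := by
    refine hjd.hasDerivAt.congr_of_eventuallyEq ?_
    filter_upwards [Icc_mem_nhds ht.1 ht.2] with s hs
    exact rate_of_mem h hs
  have hlog := (hjd.hasDerivAt.log hjp.ne').deriv
  have h1 := ((hasDerivAt_integral_exitRate hj z t t).neg.exp.mul hrate).mul
    (hasDerivAt_integral_exitRate hj z' t t).exp
  refine h1.congr_deriv ?_
  simp only [Pi.mul_apply, Pi.neg_apply, intervalIntegral.integral_same, neg_zero, Real.exp_zero,
    rate_of_mem h ht', exitRate_of_mem _ ht', arcCharacteristic, hlog]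
  field_simp
  ring

end Weight

end RecipWalk

/-! ### Conditional probabilities under the reciprocal class -/

namespace RecipWalk

theorem measureReal_cond {Ω : Type*} [MeasurableSpace Ω] (P : Measure Ω) {S : Set Ω}
    (hS : MeasurableSet S) (E : Set Ω) :
    (ProbabilityTheory.cond P S).real E = P.real (S ∩ E) / P.real S := by
  rw [measureReal_def, cond_apply hS, ENNReal.toReal_mul, ENNReal.toReal_inv, div_eq_inv_mul]
  rfl

section Final

variable {V : Type*} [Countable V] {G : SimpleGraph V} [G.LocallyFinite] {j : ℝ → V → V → ℝ}
  {P : Measure (PathSpace G)}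

/-- In the conditional law of the time of a single jump, the unknown constant and the factors that
depend only on the endpoints of the time interval cancel. -/
theorem measureReal_cond_jumpTime_le (hconn : G.Preconnected) (hj : IsAdmissibleIntensity G j)
    (hP : P ∈ reciprocalClass G j) {t u s : ℝ} (ht : 0 < t) (htu : t ≤ u) (hus : u ≤ s)
    (hts : t < s) (hs : s < 1) {z z' : V} (h : G.Adj z z') :
    (ProbabilityTheory.cond P {w | pos t w = z ∧ pos s w = z' ∧
      (s : EReal) < jumpTime t 2 w}).real {w | jumpTime t 1 w ≤ (u : EReal)} =
      (∫ r in t..u, jumpDensity G j t z z' r) / ∫ r in t..s, jumpDensity G j t z z' r := by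
  obtain ⟨K, hK, hKA⟩ := exists_measureReal_eq_mul hconn hj hP ht hts hs z z'
  have hu1 : u ≤ 1 := hus.trans hs.le
  set S := {w : PathSpace G | skeleton t s w = [z', z]} with hS
  have hSeq : {w : PathSpace G | pos t w = z ∧ pos s w = z' ∧ (s : EReal) < jumpTime t 2 w} =
      S := by
    ext w; exact (skeleton_eq_pair_iff ht.le hts.le hs.le w h.ne).symm
  have hB : ∀ s', t ≤ s' → s' ≤ 1 → {w : PathSpace G | skeleton t s' w = [z', z]} =
      {w | pos t w = z} ∩ {w | skeleton t s' w = [z', z]} := fun s' h1 h2 =>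
    (inter_eq_right.2 fun w hw => ((skeleton_eq_pair_iff ht.le h1 h2 w h.ne).1 hw).1).symm
  have hSI : S ∩ {w | jumpTime t 1 w ≤ (u : EReal)} =
      {w | skeleton t u w = [z', z]} ∩ {w | skeleton u s w = [z']} := by
    ext w; exact skeleton_pair_and_jumpTime_le_iff ht.le htu hus hs.le w h.ne
  have hSm : MeasurableSet[past G s] S := measurableSet_past_skeleton ht.le hts.le hs.le _
  have hSu : MeasurableSet[past G u] {w : PathSpace G | skeleton t u w = [z', z]} :=
    measurableSet_past_skeleton ht.le htu hu1 _
  have hp := measurableSet_past_pos_eq (G := G) (le_refl t) z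
  have h1 := hKA S _ (walkWeight_nonneg hj hts.le z [z', z]) hSm
    (fun w hw => ((skeleton_eq_pair_iff ht.le hts.le hs.le w h.ne).1 hw).2.1)
    (fun x Q hQ => by
      rw [hS, hB s hts.le hs.le]
      exact hQ.measureReal_skeleton hj ht.le hts.le hs.le hp (fun w hw => hw) _)
  have h2 := hKA ({w | skeleton t u w = [z', z]} ∩ {w | skeleton u s w = [z']}) _
    (mul_nonneg (walkWeight_nonneg hj htu z [z', z]) (walkWeight_nonneg hj hus z' [z']))
    ((past_mono hus _ hSu).inter (measurableSet_past_skeleton (ht.le.trans htu) hus hs.le _))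
    (fun w hw => by
      rw [← hSI] at hw
      exact ((skeleton_eq_pair_iff ht.le hts.le hs.le w h.ne).1 hw.1).2.1)
    (fun x Q hQ => by
      rw [hQ.measureReal_skeleton hj (ht.le.trans htu) hus hs.le hSu
        (fun w hw => ((skeleton_eq_pair_iff ht.le htu hu1 w h.ne).1 hw).2.1), ← mul_assoc]
      congr 1
      rw [hB u htu hu1]
      exact hQ.measureReal_skeleton hj ht.le htu hu1 hp (fun w hw => hw) _)
  rw [hSeq, measureReal_cond P (past_le s _ hSm), hSI, h1, h2, mul_div_mul_left _ _ hK.ne',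
    walkWeight_pair_mul_singleton hj, walkWeight_pair, mul_div_mul_left _ _ (Real.exp_ne_zero _)]

/-- The event of following `f` up to its `n`-th state differs from an event on the skeleton only by
a jump at the fixed time `s`, which has probability zero. -/
theorem measureReal_cond_follows (hconn : G.Preconnected) (hj : IsAdmissibleIntensity G j)
    (hP : P ∈ reciprocalClass G j) {t s : ℝ} (ht : 0 < t) (hts : t < s) (hs : s < 1)
    (f : ℕ → V) (n : ℕ) (hf : f n = f 0) :
    (ProbabilityTheory.cond P {w | pos t w = f 0 ∧ pos s w = f 0}).real
        {w | (∀ i ≤ n, pos (jumpTime t i w).toReal w = f i) ∧ jumpTime t n w < (s : EReal) ∧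
          (s : EReal) < jumpTime t (n + 1) w} =
      walkWeight G j t (f 0) (history f n) s / (transitionProb G j t s (f 0) (f 0)).toReal := by
  have hs01 : s ∈ Icc (0 : ℝ) 1 := ⟨ht.le.trans hts.le, hs.le⟩
  obtain ⟨K, hK, hKA⟩ := exists_measureReal_eq_mul hconn hj hP ht hts hs (f 0) (f 0)
  set S := {w : PathSpace G | pos t w = f 0 ∧ pos s w = f 0} with hS
  set A := {w : PathSpace G | skeleton t s w = history f n} with hA
  have hAt : ∀ w ∈ A, pos t w = f 0 := fun w hw => by
    simpa [jumpTime] using (pos_of_skeleton_eq_history hw).2 0 (Nat.zero_le _)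
  have hAs : ∀ w ∈ A, pos s w = f 0 := fun w hw => by
    have h := head?_skeleton ht.le hts.le hs.le w
    rw [show skeleton t s w = history f n from hw, head?_history, hf] at h
    simpa using h.symm
  have hp := measurableSet_past_pos_eq (G := G) (le_refl t) (f 0)
  have hSm : MeasurableSet[past G s] S :=
    (past_mono hts.le _ hp).inter (measurableSet_past_pos_eq le_rfl (f 0))
  have h1 := hKA S _ ENNReal.toReal_nonneg hSm (fun w hw => hw.2) (fun x Q hQ => by
    have h := congrArg ENNReal.toReal
      (hQ.measure_pos_eq hj ht.le hts.le hs.le hp (fun w hw => hw) (f 0))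
    rw [ENNReal.toReal_mul] at h
    exact h)
  have h2 := hKA A _ (walkWeight_nonneg hj hts.le (f 0) (history f n))
    (measurableSet_past_skeleton ht.le hts.le hs.le _) hAs (fun x Q hQ => by
      rw [← hQ.measureReal_skeleton hj ht.le hts.le hs.le hp (fun w hw => hw)]
      congr 1
      exact (inter_eq_right.2 hAt).symm)
  have hae : (S ∩ {w | (∀ i ≤ n, pos (jumpTime t i w).toReal w = f i) ∧
      jumpTime t n w < (s : EReal) ∧ (s : EReal) < jumpTime t (n + 1) w} : Set _) =ᵐ[P] A := by
    have hnull : ∀ᵐ w ∂P, ¬ IsJump w.1 ⟨s, hs01⟩ := by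
      rw [ae_iff]
      simp only [not_not]
      exact measure_isJump_of_mem_reciprocalClass hj hP hs01 (ht.trans hts)
    filter_upwards [hnull] with w hw
    have h := follows_iff_skeleton hts hs01 w f n hw
    refine propext ⟨fun hw => h.1 hw.2, fun hw => ⟨⟨hAt w hw, hAs w hw⟩, h.2 hw⟩⟩
  rw [measureReal_cond P (past_le s _ hSm), measureReal_congr hae, h1, h2,
    mul_div_mul_left _ _ hK.ne']

theorem tendsto_transitionProb_self (hconn : G.Preconnected) (hj : IsAdmissibleIntensity G j)
    (hP : P ∈ reciprocalClass G j) {t : ℝ} (ht : t ∈ Ioo (0 : ℝ) 1) (a : V) :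
    Tendsto (fun s => (transitionProb G j t s a a).toReal) (𝓝[>] t) (𝓝 1) := by
  obtain ⟨x, Q, hQ⟩ := exists_solution_of_mem_reciprocalClass hP
  have hlow : Tendsto (fun s => Real.exp (-∫ r in t..s, exitRate G j a r)) (𝓝[>] t) (𝓝 1) := by
    have h : Tendsto (fun s => Real.exp (-∫ r in t..s, exitRate G j a r)) (𝓝 t)
        (𝓝 (Real.exp (-∫ r in t..t, exitRate G j a r))) :=
      (Real.continuous_exp.comp (continuous_integral_exitRate hj a t).neg).tendsto t
    rw [intervalIntegral.integral_same, neg_zero, Real.exp_zero] at h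
    exact h.mono_left nhdsWithin_le_nhds
  refine tendsto_of_tendsto_of_tendsto_of_le_of_le' hlow tendsto_const_nhds ?_ ?_
  · filter_upwards [Ioo_mem_nhdsGT ht.2] with s hs
    exact (hQ.transitionProb_bounds hconn hj ht.1 hs.1.le hs.2.le a).1
  · filter_upwards [Ioo_mem_nhdsGT ht.2] with s hs
    exact (hQ.transitionProb_bounds hconn hj ht.1 hs.1.le hs.2.le a).2

end Final

end RecipWalk

theorem theorem2p6 {V : Type*} [Countable V] (G : SimpleGraph V) [G.LocallyFinite]
    (hconn : G.Preconnected) (hdeg : ∃ D : ℕ, ∀ z, G.degree z ≤ D)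
    (j : ℝ → V → V → ℝ) (hj : RecipWalk.IsAdmissibleIntensity G j)
    (P : Measure (RecipWalk.PathSpace G)) (hP : P ∈ RecipWalk.reciprocalClass G j) :
    (∀ t ∈ Ioo (0 : ℝ) 1, ∀ z z' : V, G.Adj z z' →
      (fun h : ℝ =>
          (ProbabilityTheory.cond P
            {w | RecipWalk.pos t w = z ∧ RecipWalk.pos (t + h) w = z' ∧
              ((t + h : ℝ) : EReal) < RecipWalk.jumpTime t 2 w}).real
            {w | RecipWalk.jumpTime t 1 w ≤ ((t + h / 2 : ℝ) : EReal)}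
          - (1 / 2 - h / 8 * RecipWalk.arcCharacteristic G j t z z'))
        =o[𝓝[>] 0] fun h : ℝ => h) ∧
    (∀ t ∈ Ioo (0 : ℝ) 1, ∀ (x : V) (c : G.Walk x x), 0 < c.length →
      (fun h : ℝ =>
          (ProbabilityTheory.cond P
            {w | RecipWalk.pos t w = x ∧ RecipWalk.pos (t + h) w = x}).real
            {w | (∀ i ≤ c.length,
                RecipWalk.pos (RecipWalk.jumpTime t i w).toReal w = c.getVert i) ∧
              RecipWalk.jumpTime t c.length w < ((t + h : ℝ) : EReal) ∧
              ((t + h : ℝ) : EReal) < RecipWalk.jumpTime t (c.length + 1) w}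
          - RecipWalk.walkCharacteristic j t c * h ^ c.length / (c.length.factorial : ℝ))
        =o[𝓝[>] 0] fun h : ℝ => h ^ c.length) := by
  refine ⟨fun t ht z z' hzz => ?_, fun t ht x c hc => ?_⟩
  · have hlim := RecipWalk.isLittleO_integral_ratio
      (RecipWalk.continuous_jumpDensity hj t z z') (RecipWalk.hasDerivAt_jumpDensity hj ht hzz)
      (by rw [RecipWalk.jumpDensity_self (Ioo_subset_Icc_self ht) hzz]
          exact (hj.pos t (Ioo_subset_Icc_self ht) z z' hzz).ne')
    rw [RecipWalk.jumpDensity_self (Ioo_subset_Icc_self ht) hzz,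
      mul_div_cancel_left₀ _ (hj.pos t (Ioo_subset_Icc_self ht) z z' hzz).ne'] at hlim
    refine hlim.congr' ?_ EventuallyEq.rfl
    filter_upwards [Ioo_mem_nhdsGT (sub_pos.2 ht.2)] with h hh
    rw [RecipWalk.measureReal_cond_jumpTime_le hconn hj hP ht.1 (u := t + h / 2)
      (by linarith [hh.1]) (by linarith [hh.1]) (by linarith [hh.1]) (by linarith [hh.2]) hzz]
  · set n := c.length with hn
    have h0 : c.getVert 0 = x := c.getVert_zero
    have hcn : c.getVert n = c.getVert 0 := by rw [hn, c.getVert_length, h0]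
    set χ := RecipWalk.walkCharacteristic j t c with hχ
    have hχ' : ∏ i ∈ Finset.range n, RecipWalk.rate G j (c.getVert i) (c.getVert (i + 1)) t =
        χ := Finset.prod_congr rfl fun i hi => RecipWalk.rate_of_mem
      (c.adj_getVert_succ (Finset.mem_range.1 hi)) (Ioo_subset_Icc_self ht)
    have hW := (RecipWalk.tendsto_walkWeight_history_div hj t c.getVert n).comp
      (RecipWalk.tendsto_const_add_nhdsGT t)
    have hT := (RecipWalk.tendsto_transitionProb_self hconn hj hP ht x).comp
      (RecipWalk.tendsto_const_add_nhdsGT t)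
    rw [hχ', h0] at hW
    have hlim := (hW.div hT one_ne_zero).sub_const (χ / (n.factorial : ℝ))
    rw [div_one, sub_self] at hlim
    rw [isLittleO_iff_tendsto' (by
      filter_upwards [self_mem_nhdsWithin] with h hh h'
      exact absurd h' (pow_ne_zero _ (ne_of_gt hh)))]
    refine hlim.congr' ?_
    filter_upwards [Ioo_mem_nhdsGT (sub_pos.2 ht.2)] with h hh
    have hh0 : (0 : ℝ) < h := hh.1
    have hprob := RecipWalk.measureReal_cond_follows hconn hj hP ht.1 (s := t + h)
      (by linarith) (by linarith [hh.2]) c.getVert n hcn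
    rw [h0] at hprob
    rw [hprob]
    simp only [Function.comp, Pi.div_apply, add_sub_cancel_left]
    field_simp
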